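/- Let $M$ be a real analytic surface. A pair $(L,e)$, where $L$ is an analytic field of endomorphisms of $TM$ and $e$ an analytic vector field, is called a Nijenhuis operator with a unity if the Nijenhuis torsion $\mathcal N_L(\xi,\eta)=[L\xi,L\eta]+L^2[\xi,\eta]-L[L\xi,\eta]-L[\xi,L\eta]$ vanishes identically and $\mathcal L_eL=\mathrm{Id}$, where $\mathcal L_e$ is the Lie derivative. All coordinate systems, diffeomorphisms and functions below are real analytic. (a) If $(L,e)$ is a Nijenhuis operator with a unity on $M$ and $p\in M$, then there are local coordinates $(x,y)$ centred at $p$ in which $e=\partial_x$ and, for some $\lambda_0\in\mathbb R$, the matrix of $L$ is one of 1. $\begin{pmatrix}\lambda_0+x&0\\0&\lambda_0+x\end{pmatrix}$; 2. $\lambda_0\mathrm{Id}+\begin{pmatrix}x&-\frac12\\2(y+d)&x\end{pmatrix}$ with $d\in\mathbb R$; 3. $\lambda_0\mathrm{Id}+\begin{pmatrix}x&\mp\frac k2y^{k-1}\\\frac2ky&x\end{pmatrix}$ with an integer $k\ge1$ and one of the two signs; 4. $\lambda_0\mathrm{Id}+\begin{pmatrix}x&0\\f&x\end{pmatrix}$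 with $f=f(y)$ a function, analytic near $0$, of $y$ alone. Conversely, for all values of $\lambda_0$, $d$, $k\ge1$, the sign, and for every function $f(y)$ analytic near $0$, the operator in 1–4 together with $e=\partial_x$ is a Nijenhuis operator with a unity near the origin. (b) Let $\lambda_0\in\mathbb R$ and let $f(x,y)$, $\bar f(x,y)$ be analytic near $(0,0)$. There is a local diffeomorphism of $\mathbb R^2$ fixing the origin that transforms the operator $\lambda_0\mathrm{Id}+\begin{pmatrix}x&0\\f(x,y)&x\end{pmatrix}$ into $\lambda_0\mathrm{Id}+\begin{pmatrix}x&0\\\bar f(x,y)&x\end{pmatrix}$ near the origin if and only if there is a function $h(x,y)$, analytic near $(0,0)$, with $$h(0,0)=0,\qquad \frac{\partial h}{\partial y}(0,0)\ne0,\qquad \bar f(x,h(x,y))=\frac{\partial h}{\partial y}(x,y)\,f(x,y)\ \text{ near }(0,0).$$ If $f$ and $\bar f$ depend on $y$ alone, the same condition is also necessary and sufficient for the existence of such a diffeomorphism that in addition preserves $e=\partial_x$, that is, for the equivalence of the corresponding pairs $(L,e)$. -/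

import Mathlib

open scoped Manifold ContDiff Topology Bundle

noncomputable section

namespace NijenhuisUnity

/-- The coordinate plane `ℝ²`, with coordinates `x = u 0` and `y = u 1`. -/
abbrev Plane : Type := EuclideanSpace ℝ (Fin 2)

section Fields

variable (M : Type*) [TopologicalSpace M] [ChartedSpace Plane M]

/-- Vector fields on a surface (no regularity imposed). -/
abbrev VField : Type _ := ∀ q : M, TangentSpace (𝓡 2) q

/-- Operator fields, that is, fields of endomorphisms of the tangent spaces
(no regularity imposed). -/
abbrev OpField : Type _ := ∀ q : M, TangentSpace (𝓡 2) q →L[ℝ] TangentSpace (𝓡 2) q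

end Fields

section Manifold

variable {M : Type*} [TopologicalSpace M] [ChartedSpace Plane M]

/-- The vector field `ξ` is real analytic near `q`. -/
def AnalyticVFieldAt [IsManifold (𝓡 2) ω M] (ξ : VField M) (q : M) : Prop :=
  ContMDiffAt (𝓡 2) (𝓡 2).tangent ω (fun r => (⟨r, ξ r⟩ : TangentBundle (𝓡 2) M)) q

/-- The operator field `L` is real analytic, as a section of the bundle `End(TM)`. -/
def AnalyticOpField [IsManifold (𝓡 2) ω M] (L : OpField M) : Prop :=
  ContMDiff (𝓡 2) ((𝓡 2).prod 𝓘(ℝ, Plane →L[ℝ] Plane)) ω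
    (fun q => Bundle.TotalSpace.mk' (Plane →L[ℝ] Plane)
      (E := fun q : M => TangentSpace (𝓡 2) q →L[ℝ] TangentSpace (𝓡 2) q) q (L q))

/-- The vector field `L ξ`. -/
def OpField.app (L : OpField M) (ξ : VField M) : VField M := fun q => L q (ξ q)

/-- The value at `q` of the Nijenhuis torsion
`N_L(ξ, η) = [Lξ, Lη] + L²[ξ, η] - L[Lξ, η] - L[ξ, Lη]`. -/
def torsion (L : OpField M) (ξ η : VField M) (q : M) : TangentSpace (𝓡 2) q :=
  VectorField.mlieBracket (𝓡 2) (L.app ξ) (L.app η) q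
    + L q (L q (VectorField.mlieBracket (𝓡 2) ξ η q))
    - L q (VectorField.mlieBracket (𝓡 2) (L.app ξ) η q)
    - L q (VectorField.mlieBracket (𝓡 2) ξ (L.app η) q)

/-- The value at `q` of `(𝓛_e L) ξ = [e, Lξ] - L[e, ξ]`. -/
def lieDerivOp (e : VField M) (L : OpField M) (ξ : VField M) (q : M) : TangentSpace (𝓡 2) q :=
  VectorField.mlieBracket (𝓡 2) e (L.app ξ) q - L q (VectorField.mlieBracket (𝓡 2) e ξ q)

/-- The Nijenhuis torsion of `L` vanishes at `q`. -/
def TorsionFreeAt [IsManifold (𝓡 2) ω M] (L : OpField M) (q : M) : Prop :=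
  ∀ ξ η : VField M, AnalyticVFieldAt ξ q → AnalyticVFieldAt η q → torsion L ξ η q = 0

/-- The identity `𝓛_e L = Id` holds at `q`. -/
def UnityAt [IsManifold (𝓡 2) ω M] (L : OpField M) (e : VField M) (q : M) : Prop :=
  ∀ ξ : VField M, AnalyticVFieldAt ξ q → lieDerivOp e L ξ q = ξ q

/-- `(L, e)` is a real analytic Nijenhuis operator with a unity on the surface `M`. -/
structure IsNijenhuisWithUnity [IsManifold (𝓡 2) ω M] (L : OpField M) (e : VField M) : Prop where
  analytic_op : AnalyticOpField L
  analytic_field : ∀ q, AnalyticVFieldAt e q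
  torsion_free : ∀ q, TorsionFreeAt L q
  unity : ∀ q, UnityAt L e q

variable {N : Type*} [TopologicalSpace N] [ChartedSpace Plane N]

/-- `Φ` is an analytic diffeomorphism from a neighbourhood of `p` onto a neighbourhood of `p'`
which sends `p` to `p'`. For `N = ℝ²` and `p' = 0` these are the local analytic
coordinate systems centred at `p`. -/
structure IsLocalAnalyticDiffeo (Φ : OpenPartialHomeomorph M N) (p : M) (p' : N) : Prop where
  mem_source : p ∈ Φ.source
  map_point : Φ p = p'
  analytic : ContMDiffOn (𝓡 2) (𝓡 2) ω Φ Φ.source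
  analytic_symm : ContMDiffOn (𝓡 2) (𝓡 2) ω Φ.symm Φ.target

/-- `Φ` transforms the operator field `L` into `L'`. -/
def MapsOp (Φ : OpenPartialHomeomorph M N) (L : OpField M) (L' : OpField N) : Prop :=
  ∀ q ∈ Φ.source, ∀ v : TangentSpace (𝓡 2) q,
    mfderiv (𝓡 2) (𝓡 2) Φ q (L q v) = L' (Φ q) (mfderiv (𝓡 2) (𝓡 2) Φ q v)

/-- `Φ` transforms the vector field `e` into `e'`. -/
def MapsField (Φ : OpenPartialHomeomorph M N) (e : VField M) (e' : VField N) : Prop :=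
  ∀ q ∈ Φ.source, mfderiv (𝓡 2) (𝓡 2) Φ q (e q) = e' (Φ q)

/-- Local equivalence of `L` near `p` and `L'` near `p'`. -/
def OpEquiv (L : OpField M) (p : M) (L' : OpField N) (p' : N) : Prop :=
  ∃ Φ : OpenPartialHomeomorph M N, IsLocalAnalyticDiffeo Φ p p' ∧ MapsOp Φ L L'

/-- Local equivalence of the pair `(L, e)` near `p` and the pair `(L', e')` near `p'`. -/
def PairEquiv (L : OpField M) (e : VField M) (p : M)
    (L' : OpField N) (e' : VField N) (p' : N) : Prop :=
  ∃ Φ : OpenPartialHomeomorph M N,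
    IsLocalAnalyticDiffeo Φ p p' ∧ MapsOp Φ L L' ∧ MapsField Φ e e'

end Manifold

/-- The operator field on the plane with the matrix `A x y` at the point `(x, y)`; the columns
are the images of `∂_x` and `∂_y`. -/
def opOfMatrix (A : ℝ → ℝ → Matrix (Fin 2) (Fin 2) ℝ) : OpField Plane :=
  fun u => Matrix.toEuclideanCLM (n := Fin 2) (𝕜 := ℝ) (A (u 0) (u 1))

/-- The coordinate field `∂_x`. -/
def dX : VField Plane := fun _ => (!₂[(1 : ℝ), 0] : Plane)

def form₁ (l : ℝ) : OpField Plane :=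
  opOfMatrix fun x _ => !![l + x, 0; 0, l + x]

def form₂ (l d : ℝ) : OpField Plane :=
  opOfMatrix fun x y => !![l, 0; 0, l] + !![x, -(1 / 2); 2 * (y + d), x]

/-- The sign `s` is `1` or `-1`; the upper right entry is `∓ (k / 2) y ^ (k - 1)`. -/
def form₃ (l s : ℝ) (k : ℕ) : OpField Plane :=
  opOfMatrix fun x y =>
    !![l, 0; 0, l] + !![x, -s * ((k : ℝ) / 2) * y ^ (k - 1); (2 / (k : ℝ)) * y, x]

def form₄ (l : ℝ) (f : ℝ × ℝ → ℝ) : OpField Plane :=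
  opOfMatrix fun x y => !![l, 0; 0, l] + !![x, 0; f (x, y), x]

/-- There is an analytic function germ `h(x, y)` at the origin with `h(0, 0) = 0`,
`h_y(0, 0) ≠ 0` and `f'(x, h(x, y)) = h_y(x, y) f(x, y)` near the origin. -/
def ParamEquiv (f f' : ℝ × ℝ → ℝ) : Prop :=
  ∃ h : ℝ × ℝ → ℝ, AnalyticAt ℝ h (0, 0) ∧ h (0, 0) = 0 ∧
    deriv (fun t => h (0, t)) 0 ≠ 0 ∧
    ∀ᶠ z : ℝ × ℝ in 𝓝 (0, 0), f' (z.1, h z) = deriv (fun t => h (z.1, t)) z.2 * f z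

/-- Near the origin, `L` is Nijenhuis and `∂_x` is a unity for it. -/
def IsModelNearZero (L : OpField Plane) : Prop :=
  ∀ᶠ u : Plane in 𝓝 0, TorsionFreeAt L u ∧ UnityAt L dX u

end NijenhuisUnity

end

/-! Part (a). Taking traces in `𝓛_e L = Id` gives `e(tr L) = 2`. So `e` has no zeros, and half the
trace, up to a constant `λ₀`, is a function `x` with `e(x) = 1`. Together with a first integral `y`
of `e` it forms coordinates in which `e = ∂_x`, `∂_x L = Id` and `tr L = 2(λ₀ + x)`. One component
of the torsion then forces equal diagonal entries, so `L` has the matrix `(λ₀ + x, b(y); c(y), λ₀ +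
x)`, and the other component is the equation `(bc)' = 2b`.

The remaining freedom used is `y ↦ φ(y)`, under which the product `D = bc` behaves as a function. If
`b = 0`, this is form 4. If `D(0) ≠ 0`, then `b(0) ≠ 0` and `D(0) - D` is a coordinate; it gives
form 2. Otherwise `D(0) = 0` while `D` is not identically zero, so `D = ∓φ^k` in a suitable
coordinate `φ`, and `b = D'/2`, `c = D/b` give form 3. The converse is the same torsion computation
read backwards.

The first integral needs an analytic flow. The superposition operator `γ ↦ e ∘ γ` is analytic on
`C([0,1], E)`, so the inverse function theorem solves `γ = w + t ∫ e(γ)` analytically in `(t, w)`,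
and the end point `γ(1)` is the flow.

Part (b). The only eigenvalue of `L` is `λ₀ + x`, so an equivalence preserves `x` and has the form
`(x, y) ↦ (x, h(x, y))`. The intertwining relation then reduces to its lower left entry, which is
the equation for `h`. If `f` and `f̄` depend on `y` alone, `h(0, y)` is another solution, and its
diffeomorphism preserves `∂_x`.

The main steps are `exists_analytic_flow`, `exists_first_integral`, `exists_straightened`,
`exists_normalOp_of_straightened`, `exists_normal_form` and `paramEquiv_of_opEquiv_form₄`. -/

noncomputable section

namespace NijenhuisUnity

/-! ### Analytic flows -/

section Superposition

variable {K E F : Type*} [TopologicalSpace K] [CompactSpace K]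
  [NormedAddCommGroup E] [NormedSpace ℝ E] [NormedAddCommGroup F] [NormedSpace ℝ F]

/-- The pointwise action of a multilinear map on continuous functions. -/
def liftMultilinear (K : Type*) [TopologicalSpace K] [CompactSpace K] {n : ℕ}
    (m : ContinuousMultilinearMap ℝ (fun _ : Fin n => E) F) :
    ContinuousMultilinearMap ℝ (fun _ : Fin n => C(K, E)) C(K, F) :=
  MultilinearMap.mkContinuous
    { toFun := fun f => ⟨fun s => m fun i => f i s, by fun_prop⟩
      map_update_add' := by
        intro _ f i a b
        ext s
        have key : ∀ c : C(K, E), (fun j => (Function.update f i c j) s) =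
            Function.update (fun j => f j s) i (c s) := by
          intro c; ext j; by_cases h : j = i
          · subst h; simp
          · simp [h]
        simp [key]
      map_update_smul' := by
        intro _ f i a b
        ext s
        have key : ∀ c : C(K, E), (fun j => (Function.update f i c j) s) =
            Function.update (fun j => f j s) i (c s) := by
          intro c; ext j; by_cases h : j = i
          · subst h; simp
          · simp [h]
        simp [key] } ‖m‖ (by
      intro f
      refine (ContinuousMap.norm_le _ (by positivity)).2 fun s => ?_
      refine (m.le_opNorm _).trans ?_
      gcongr with i
      exact (f i).norm_coe_le_norm s)

theorem norm_liftMultilinear_le {n : ℕ}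
    (m : ContinuousMultilinearMap ℝ (fun _ : Fin n => E) F) : ‖liftMultilinear K m‖ ≤ ‖m‖ :=
  MultilinearMap.mkContinuous_norm_le _ (norm_nonneg _) _

/-- The superposition operator `γ ↦ e ∘ γ` defined by an analytic map `e` is analytic on the
space of continuous functions. -/
theorem exists_analytic_superposition [CompleteSpace F] {e : E → F} {w : E}
    (he : AnalyticAt ℝ e w) :
    ∃ N : C(K, E) → C(K, F), AnalyticAt ℝ N (.const K w) ∧
      ∀ᶠ γ in 𝓝 (ContinuousMap.const K w), ∀ s, N γ s = e (γ s) := by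
  obtain ⟨p, r, hp⟩ := he
  -- The power series of `e` at `w` is lifted coefficient by coefficient; norms do not grow, so the
  -- radius of convergence does not shrink.
  let P : FormalMultilinearSeries ℝ C(K, E) C(K, F) := fun n => liftMultilinear K (p n)
  have hPr : r ≤ P.radius := hp.r_le.trans
    (FormalMultilinearSeries.radius_le_of_le fun n => norm_liftMultilinear_le (p n))
  have hP := P.hasFPowerSeriesOnBall (hp.r_pos.trans_le hPr)
  refine ⟨fun γ => P.sum (γ - .const K w), ?_, ?_⟩
  · have h := hP.analyticAt
    have h' : AnalyticAt ℝ (fun γ : C(K, E) => γ - .const K w) (.const K w) := by fun_prop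
    exact AnalyticAt.fun_comp (by simpa using h) h'
  · filter_upwards [Metric.eball_mem_nhds (ContinuousMap.const K w) hp.r_pos] with γ hγ s
    have hsum := hP.hasSum (y := γ - .const K w) (by
      rw [Metric.mem_eball, edist_zero_right]
      rw [Metric.mem_eball, edist_eq_enorm_sub] at hγ
      exact hγ.trans_le hPr)
    -- Evaluated at `s`, the lifted series is the series of `e` at the point `γ s`.
    have h1 := (ContinuousMap.evalCLM ℝ s : C(K, F) →L[ℝ] F).hasSum hsum
    have h2 := hp.hasSum (y := γ s - w) (by
      rw [Metric.mem_eball, edist_zero_right]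
      rw [Metric.mem_eball, edist_eq_enorm_sub] at hγ
      refine lt_of_le_of_lt ?_ hγ
      have := (γ - .const K w).norm_coe_le_norm s
      exact enorm_le_iff_norm_le.2 this)
    simp only [zero_add] at h1
    rw [add_sub_cancel] at h2
    exact h1.unique h2

end Superposition

/-! ### The integral equation of the flow on the unit interval. -/

section Flow

open unitInterval MeasureTheory

/-- Integration from the left end point of the unit interval. -/
def primitiveCLM (E : Type*) [NormedAddCommGroup E] [NormedSpace ℝ E] : C(I, E) →L[ℝ] C(I, E) :=
  LinearMap.mkContinuous
    { toFun := fun γ => ⟨fun s => ∫ r in (0 : ℝ)..s, γ (Set.projIcc 0 1 zero_le_one r), by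
        have hc : Continuous fun r : ℝ => γ (Set.projIcc 0 1 zero_le_one r) := by fun_prop
        exact (intervalIntegral.continuous_primitive
          (fun a b => hc.intervalIntegrable a b) 0).comp continuous_subtype_val⟩
      map_add' := by
        intro a b; ext s
        have ha : Continuous fun r : ℝ => a (Set.projIcc 0 1 zero_le_one r) := by fun_prop
        have hb : Continuous fun r : ℝ => b (Set.projIcc 0 1 zero_le_one r) := by fun_prop
        exact intervalIntegral.integral_add (ha.intervalIntegrable _ _) (hb.intervalIntegrable _ _)
      map_smul' := by
        intro c a; ext s
        exact intervalIntegral.integral_smul _ _ } 1 (by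
      intro γ
      refine (ContinuousMap.norm_le _ (by positivity)).2 fun s => ?_
      refine (intervalIntegral.norm_integral_le_of_norm_le_const
        (C := ‖γ‖) fun r _ => γ.norm_coe_le_norm _).trans ?_
      rw [sub_zero, abs_of_nonneg s.2.1, one_mul]
      exact mul_le_of_le_one_right (norm_nonneg _) s.2.2)

/-- Restriction of a curve to `[0, c]`, reparametrized by `[0, 1]`. -/
def rescale {X : Type*} [TopologicalSpace X] (c : I) (γ : C(I, X)) : C(I, X) :=
  ⟨fun s => γ (c * s), by fun_prop⟩

theorem rescale_apply {X : Type*} [TopologicalSpace X] (c : I) (γ : C(I, X)) (s : I) :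
    rescale c γ s = γ (c * s) := rfl

variable {E : Type*} [NormedAddCommGroup E] [NormedSpace ℝ E]

theorem primitiveCLM_apply (γ : C(I, E)) (s : I) :
    primitiveCLM E γ s = ∫ r in (0 : ℝ)..s, γ (Set.projIcc 0 1 zero_le_one r) := rfl

/-- Substitution `r ↦ c r` in the integral. Consequently a solution curve for time `t`, restricted
to `[0, c]` and rescaled, solves the equation for time `c t`. -/
theorem primitiveCLM_rescale (c : I) (γ : C(I, E)) :
    (c : ℝ) • primitiveCLM E (rescale c γ) = rescale c (primitiveCLM E γ) := by
  ext s
  simp only [ContinuousMap.smul_apply, rescale_apply, primitiveCLM_apply]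
  have h := intervalIntegral.smul_integral_comp_mul_left (a := 0) (b := (s : ℝ))
    (fun r => γ (Set.projIcc 0 1 zero_le_one r)) (c : ℝ)
  rw [mul_zero] at h
  rw [Set.Icc.coe_mul, ← h]
  congr 1
  refine intervalIntegral.integral_congr fun r hr => ?_
  rw [Set.uIcc_of_le s.2.1] at hr
  have hr' : r ∈ Set.Icc (0 : ℝ) 1 := ⟨hr.1, hr.2.trans s.2.2⟩
  have e1 : Set.projIcc 0 1 zero_le_one r = (⟨r, hr'⟩ : I) := Set.projIcc_of_mem _ hr'
  have e2 : Set.projIcc 0 1 zero_le_one (c * r) = (c * ⟨r, hr'⟩ : I) :=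
    Set.projIcc_of_mem _ (c * ⟨r, hr'⟩ : I).2
  simp only [e1, e2]

/-- Constant curves. -/
def constCLM (E : Type*) [NormedAddCommGroup E] [NormedSpace ℝ E] : E →L[ℝ] C(I, E) :=
  LinearMap.mkContinuous
    { toFun := fun w => .const I w
      map_add' := fun _ _ => rfl
      map_smul' := fun _ _ => rfl } 1 fun w => by
    refine (ContinuousMap.norm_le _ (by positivity)).2 fun s => ?_
    rw [one_mul]
    exact le_rfl

theorem constCLM_apply (w : E) : constCLM E w = .const I w := rfl

/-- The curves `γ : [0, 1] → E` with `γ s = w + t ∫₀ˢ N(γ)` depend analytically on the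
parameters `t` and `w`, and they are locally unique. -/
theorem exists_analytic_solution [CompleteSpace E] {N : C(I, E) → C(I, E)} {w₀ : E}
    (hN : AnalyticAt ℝ N (.const I w₀)) :
    ∃ G : ℝ × E → C(I, E), AnalyticAt ℝ G (0, w₀) ∧ G (0, w₀) = .const I w₀ ∧
      (∀ᶠ z in 𝓝 ((0, w₀) : ℝ × E), G z = .const I z.2 + z.1 • primitiveCLM E (N (G z))) ∧
      ∀ᶠ a in 𝓝 ((0, w₀, .const I w₀) : ℝ × E × C(I, E)),
        a.2.2 = .const I a.2.1 + a.1 • primitiveCLM E (N a.2.2) → a.2.2 = G (a.1, a.2.1) := by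
  set γ₀ : C(I, E) := .const I w₀ with hγ₀
  set a₀ : ℝ × E × C(I, E) := (0, w₀, γ₀) with ha₀
  -- `H` keeps the parameters and records the defect of the integral equation; inverting `H` solves
  -- the equation.
  let H : ℝ × E × C(I, E) → ℝ × E × C(I, E) := fun a =>
    (a.1, a.2.1, a.2.2 - constCLM E a.2.1 - a.1 • primitiveCLM E (N a.2.2))
  let pγ : ℝ × E × C(I, E) →L[ℝ] C(I, E) := .comp (.snd ℝ E C(I, E)) (.snd ℝ ℝ (E × C(I, E)))
  let pw : ℝ × E × C(I, E) →L[ℝ] E := .comp (.fst ℝ E C(I, E)) (.snd ℝ ℝ (E × C(I, E)))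
  let pt : ℝ × E × C(I, E) →L[ℝ] ℝ := .fst ℝ ℝ (E × C(I, E))
  have hNa : AnalyticAt ℝ (fun a : ℝ × E × C(I, E) => N a.2.2) a₀ :=
    AnalyticAt.fun_comp (g := N) (f := fun a : ℝ × E × C(I, E) => a.2.2) hN (pγ.analyticAt a₀)
  have hJN : AnalyticAt ℝ (fun a : ℝ × E × C(I, E) => primitiveCLM E (N a.2.2)) a₀ :=
    ((primitiveCLM E).analyticAt _).fun_comp hNa
  have hH : AnalyticAt ℝ H a₀ := by
    refine (pt.analyticAt a₀).prod ((pw.analyticAt a₀).prod ?_)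
    exact ((pγ.analyticAt a₀).sub (((constCLM E).comp pw).analyticAt a₀)).sub
      ((pt.analyticAt a₀).smul hJN)
  let c : C(I, E) := primitiveCLM E (N γ₀)
  -- At `t = 0` the factor `t` removes the derivative of `N`, so the differential of `H` is
  -- unipotent and is inverted by changing the sign of `q`.
  let q : ℝ × E × C(I, E) →L[ℝ] C(I, E) := (constCLM E).comp pw + pt.smulRight c
  let D : (ℝ × E × C(I, E)) ≃L[ℝ] (ℝ × E × C(I, E)) :=
    ContinuousLinearEquiv.equivOfInverse (pt.prod (pw.prod (pγ - q))) (pt.prod (pw.prod (pγ + q)))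
      (by rintro ⟨t, w, γ⟩; simp [pt, pw, pγ, q]) (by rintro ⟨t, w, γ⟩; simp [pt, pw, pγ, q])
  have hD : HasFDerivAt H (D : (ℝ × E × C(I, E)) →L[ℝ] (ℝ × E × C(I, E))) a₀ := by
    have h1 : HasFDerivAt (fun a : ℝ × E × C(I, E) => a.1 • primitiveCLM E (N a.2.2))
        (pt.smulRight c) a₀ := by
      have := (pt.hasFDerivAt (x := a₀)).smul hJN.differentiableAt.hasFDerivAt
      refine this.congr_fderiv ?_
      ext x <;> simp [a₀, pt, c]
    refine ((pt.hasFDerivAt (x := a₀)).prodMk ((pw.hasFDerivAt (x := a₀)).prodMk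
      (((pγ.hasFDerivAt (x := a₀)).sub ((constCLM E).comp pw).hasFDerivAt).sub h1))).congr_fderiv ?_
    change _ = pt.prod (pw.prod (pγ - q))
    rw [sub_sub]
  have hHc : ContDiffAt ℝ ω H a₀ := hH.contDiffAt
  have hHa : H a₀ = (0, w₀, 0) := by
    simp [H, a₀, constCLM_apply, γ₀]
  have hn : (ω : WithTop ℕ∞) ≠ 0 := by simp
  let g := hHc.localInverse hD hn
  have hg : AnalyticAt ℝ g (0, w₀, 0) := by
    have := hHc.to_localInverse hD hn
    rw [hHa] at this
    exact this.analyticAt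
  have hstrict := hHc.hasStrictFDerivAt' hD hn
  have hleft : ∀ᶠ a in 𝓝 a₀, g (H a) = a := hstrict.eventually_left_inverse
  have hright : ∀ᶠ b in 𝓝 ((0, w₀, 0) : ℝ × E × C(I, E)), H (g b) = b := by
    have := hstrict.eventually_right_inverse
    rwa [hHa] at this
  let ι : ℝ × E → ℝ × E × C(I, E) := fun z => (z.1, z.2, 0)
  have hι : AnalyticAt ℝ ι (0, w₀) := by
    refine analyticAt_fst.prod (analyticAt_snd.prod analyticAt_const)
  have hga : g (0, w₀, 0) = a₀ := by rw [← hHa]; exact hHc.localInverse_apply_image hD hn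
  refine ⟨fun z => pγ (g (ι z)), (pγ.analyticAt _).fun_comp
    (AnalyticAt.fun_comp (g := g) (f := ι) hg hι), ?_, ?_, ?_⟩
  · simp only [ι, hga]; rfl
  · have := hι.continuousAt.eventually (p := fun b => H (g b) = b) hright
    filter_upwards [this] with z hz
    simp only [H, ι, Prod.mk.injEq] at hz
    obtain ⟨h1, h2, h3⟩ := hz
    rw [h1, h2] at h3
    change (g (z.1, z.2, 0)).2.2 = _ + z.1 • primitiveCLM E (N (g (z.1, z.2, 0)).2.2)
    rw [sub_sub, sub_eq_zero] at h3
    exact h3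
  · filter_upwards [hleft] with a ha h
    have : H a = ι (a.1, a.2.1) := by
      simp only [H, ι, Prod.mk.injEq, true_and]
      rw [sub_sub, sub_eq_zero]
      exact h
    rw [← this, ha]
    rfl

/-- The local flow of an analytic vector field is analytic. -/
theorem exists_analytic_flow [CompleteSpace E] {e : E → E} {w₀ : E} (he : AnalyticAt ℝ e w₀) :
    ∃ Y : ℝ × E → E, AnalyticAt ℝ Y (0, w₀) ∧ (∀ᶠ w in 𝓝 w₀, Y (0, w) = w) ∧
      ∀ᶠ z in 𝓝 ((0, w₀) : ℝ × E), HasDerivAt (fun t => Y (t, z.2)) (e (Y z)) z.1 := by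
  obtain ⟨N, hN, hNe⟩ := exists_analytic_superposition (K := I) he
  obtain ⟨G, hG, hG0, hGe, hGu⟩ := exists_analytic_solution hN
  obtain ⟨ε, hε, hNε⟩ := Metric.eventually_nhds_iff.1 hNe
  obtain ⟨δ, hδ, hGδ⟩ := Metric.eventually_nhds_iff.1 hGu
  have hGc : ∀ᶠ z in 𝓝 ((0, w₀) : ℝ × E), dist (G z) (.const I w₀) < min ε δ := by
    have := hG.continuousAt.eventually (Metric.ball_mem_nhds _ (lt_min hε hδ))
    rwa [hG0] at this
  -- The curve `G (t, w)` runs through the trajectory of `w` from time `0` to time `t`, so its end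
  -- point is the flow.
  let Y : ℝ × E → E := fun z => G z 1
  have hY : AnalyticAt ℝ Y (0, w₀) :=
    ((ContinuousMap.evalCLM ℝ (1 : I) : C(I, E) →L[ℝ] E).analyticAt _).fun_comp hG
  have hY0 : Y (0, w₀) = w₀ := by simp [Y, hG0]
  have hYe : ∀ᶠ z in 𝓝 ((0, w₀) : ℝ × E), AnalyticAt ℝ e (Y z) := by
    refine hY.continuousAt.eventually ?_
    rw [hY0]; exact he.eventually_analyticAt
  obtain ⟨ρ, hρ, hall⟩ := Metric.eventually_nhds_iff.1
    (hGe.and (hGc.and (hYe.and hY.eventually_analyticAt)))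
  -- Local uniqueness identifies the rescaled curve with the solution for `c t`. In particular `G
  -- (t, w) c = Y (c t, w)`.
  have hresc : ∀ t w, dist (t, w) ((0, w₀) : ℝ × E) < min ρ δ → ∀ c : I,
      rescale c (G (t, w)) = G (c * t, w) := by
    intro t w h c
    have hct : |(c : ℝ) * t| ≤ |t| := by
      rw [abs_mul, abs_of_nonneg c.2.1]
      exact mul_le_of_le_one_left (abs_nonneg _) c.2.2
    have h1 := hall (h.trans_le (min_le_left _ _))
    have hd : ∀ s, dist (rescale c (G (t, w)) s) w₀ < min ε δ := fun s =>
      ((ContinuousMap.dist_apply_le_dist (f := G (t, w)) (g := .const I w₀) (c * s)).trans_lt h1.2.1)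
    have hdist : dist (rescale c (G (t, w))) (.const I w₀) < min ε δ :=
      (ContinuousMap.dist_lt_iff_of_nonempty).2 fun s => hd s
    have h2 := h.trans_le (min_le_right _ _)
    rw [Prod.dist_eq, max_lt_iff] at h2
    refine hGδ (y := (c * t, w, rescale c (G (t, w)))) ?_ ?_
    · simp only [Prod.dist_eq, max_lt_iff]
      refine ⟨?_, h2.2, hdist.trans_le (min_le_right _ _)⟩
      have := h2.1
      simp only [Real.dist_eq, sub_zero] at this ⊢
      exact hct.trans_lt this
    · have hNr : N (rescale c (G (t, w))) = rescale c (N (G (t, w))) := by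
        ext s
        rw [hNε (hdist.trans_le (min_le_left _ _)), rescale_apply, rescale_apply,
          hNε (h1.2.1.trans_le (min_le_left _ _))]
      change rescale c (G (t, w)) = .const I w + (c * t : ℝ) • primitiveCLM E _
      rw [hNr, mul_comm, mul_smul, primitiveCLM_rescale]
      conv_lhs => rw [h1.1]
      ext s; rfl
  -- The equation at `s = 1`, with `r t` as the new integration variable, is the integral form of
  -- the differential equation for `Y`.
  have hint : ∀ t w, dist (t, w) ((0, w₀) : ℝ × E) < min ρ δ →
      Y (t, w) = w + ∫ r in (0 : ℝ)..t, e (Y (r, w)) := by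
    intro t w h
    have h1 := hall (h.trans_le (min_le_left _ _))
    have h2 := congrArg (fun γ : C(I, E) => γ 1) h1.1
    simp only [ContinuousMap.add_apply, ContinuousMap.smul_apply, primitiveCLM_apply,
      ContinuousMap.const_apply] at h2
    change Y (t, w) = _ at h2
    rw [h2]
    congr 1
    have h3 := intervalIntegral.smul_integral_comp_mul_left (a := 0) (b := (1 : ℝ))
      (fun r => e (Y (r, w))) t
    rw [mul_zero, mul_one] at h3
    rw [← h3]
    congr 1
    change ∫ r in (0 : ℝ)..1, _ = _
    refine intervalIntegral.integral_congr fun r hr => ?_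
    rw [Set.uIcc_of_le zero_le_one] at hr
    simp only [Set.projIcc_of_mem _ hr]
    rw [hNε (h1.2.1.trans_le (min_le_left _ _))]
    congr 1
    have h4 := congrArg (fun γ : C(I, E) => γ 1) (hresc t w h ⟨r, hr⟩)
    simp only [rescale_apply, mul_one] at h4
    rw [h4, mul_comm]
  have hnear : ∀ᶠ z in 𝓝 ((0, w₀) : ℝ × E), dist z ((0, w₀) : ℝ × E) < min ρ δ :=
    Metric.ball_mem_nhds _ (lt_min hρ hδ)
  refine ⟨Y, hY, ?_, ?_⟩
  · have hc : ContinuousAt (fun w : E => ((0 : ℝ), w)) w₀ := by fun_prop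
    filter_upwards [hc.eventually hnear] with w hw
    rw [hint 0 w hw]; simp
  · filter_upwards [hnear] with z hz
    obtain ⟨t, w⟩ := z
    have hz' := hz
    rw [Prod.dist_eq, max_lt_iff] at hz
    simp only [Real.dist_eq, sub_zero] at hz
    have hcont : ∀ r, |r| < min ρ δ → ContinuousAt (fun r => e (Y (r, w))) r := by
      intro r hr
      have hd : dist (r, w) ((0, w₀) : ℝ × E) < ρ := by
        simp only [Prod.dist_eq, Real.dist_eq, sub_zero, max_lt_iff]
        exact ⟨hr.trans_le (min_le_left _ _), hz.2.trans_le (min_le_left _ _)⟩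
      have h1 := hall hd
      have h2 : ContinuousAt (fun r : ℝ => (r, w)) r := by fun_prop
      have h3 : ContinuousAt (fun r => Y (r, w)) r :=
        ContinuousAt.comp (f := fun r : ℝ => (r, w)) h1.2.2.2.continuousAt h2
      exact ContinuousAt.comp (f := fun r => Y (r, w)) h1.2.2.1.continuousAt h3
    have hopen : IsOpen {r : ℝ | |r| < min ρ δ} := isOpen_lt continuous_abs continuous_const
    have hcon : ContinuousOn (fun r => e (Y (r, w))) {r : ℝ | |r| < min ρ δ} := fun r hr =>
      (hcont r hr).continuousWithinAt
    have hderiv : HasDerivAt (fun u => ∫ r in (0 : ℝ)..u, e (Y (r, w))) (e (Y (t, w))) t := by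
      refine intervalIntegral.integral_hasDerivAt_right ?_ ?_ (hcont t hz.1)
      · refine (hcon.mono fun r hr => ?_).intervalIntegrable
        have := Set.abs_sub_left_of_mem_uIcc hr
        simp only [sub_zero] at this
        exact this.trans_lt hz.1
      · exact hcon.stronglyMeasurableAtFilter hopen t hz.1
    refine (hderiv.const_add w).congr_of_eventuallyEq ?_
    filter_upwards [hopen.mem_nhds hz.1] with u hu
    refine hint u w ?_
    simp only [Prod.dist_eq, Real.dist_eq, sub_zero, max_lt_iff]
    exact ⟨hu, hz.2⟩

end Flow

/-! ### Maps into the plane -/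

theorem plane_ext {u v : Plane} (h0 : u 0 = v 0) (h1 : u 1 = v 1) : u = v := by
  ext i; fin_cases i
  · exact h0
  · exact h1

section Maps

variable {E : Type*} [NormedAddCommGroup E] [NormedSpace ℝ E]

/-- The coordinates on the plane, as linear functionals. -/
def coord (i : Fin 2) : Plane →L[ℝ] ℝ := EuclideanSpace.proj i

@[simp] theorem coord_apply (i : Fin 2) (u : Plane) : coord i u = u i := rfl

theorem analyticAt_coord {f : E → Plane} {z : E} (hf : AnalyticAt ℝ f z) (i : Fin 2) :
    AnalyticAt ℝ (fun x => f x i) z :=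
  ((coord i).analyticAt _).fun_comp hf

theorem fderiv_coord {f : E → Plane} {z : E} (hf : DifferentiableAt ℝ f z) (i : Fin 2) (v : E) :
    fderiv ℝ (fun x => f x i) z v = fderiv ℝ f z v i := by
  have := ((coord i).hasFDerivAt (x := f z)).comp z hf.hasFDerivAt
  exact congrArg (fun A : E →L[ℝ] ℝ => A v) this.fderiv

theorem analyticAt_mk {f g : E → ℝ} {z : E} (hf : AnalyticAt ℝ f z) (hg : AnalyticAt ℝ g z) :
    AnalyticAt ℝ (fun x => (!₂[f x, g x] : Plane)) z := by
  have h : AnalyticAt ℝ (fun x => f x • (!₂[1, 0] : Plane) + g x • (!₂[0, 1] : Plane)) z :=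
    (hf.smul analyticAt_const).add (hg.smul analyticAt_const)
  refine h.congr (.of_forall fun x => ?_)
  refine plane_ext ?_ ?_ <;> simp

theorem fderiv_mk {f g : E → ℝ} {z : E} (hf : DifferentiableAt ℝ f z)
    (hg : DifferentiableAt ℝ g z) (v : E) :
    fderiv ℝ (fun x => (!₂[f x, g x] : Plane)) z v = !₂[fderiv ℝ f z v, fderiv ℝ g z v] := by
  have h : DifferentiableAt ℝ (fun x => (!₂[f x, g x] : Plane)) z := by
    refine differentiableAt_euclidean.2 fun i => ?_
    fin_cases i
    · exact hf
    · exact hg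
  refine plane_ext ?_ ?_
  · rw [← fderiv_coord h]; rfl
  · rw [← fderiv_coord h]; rfl

end Maps

/-! ### Local diffeomorphisms and equivalences -/

section Equiv

variable {M : Type*} [TopologicalSpace M] [ChartedSpace Plane M]
  {N : Type*} [TopologicalSpace N] [ChartedSpace Plane N]
  {P : Type*} [TopologicalSpace P] [ChartedSpace Plane P]

/-- The inverse function theorem for analytic maps of the plane. -/
theorem exists_isLocalAnalyticDiffeo {F : Plane → Plane} {u₀ : Plane} (hF : AnalyticAt ℝ F u₀)
    (hinj : ∀ v, fderiv ℝ F u₀ v = 0 → v = 0) :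
    ∃ Φ : OpenPartialHomeomorph Plane Plane,
      IsLocalAnalyticDiffeo Φ u₀ (F u₀) ∧ ∀ u, Φ u = F u := by
  have hc : ContDiffAt ℝ ω F u₀ := hF.contDiffAt
  have hn : (ω : WithTop ℕ∞) ≠ 0 := by simp
  let D : Plane ≃L[ℝ] Plane := (LinearEquiv.ofInjectiveEndo (fderiv ℝ F u₀ : Plane →ₗ[ℝ] Plane)
    ((injective_iff_map_eq_zero _).2 hinj)).toContinuousLinearEquiv
  have hD : HasFDerivAt F (D : Plane →L[ℝ] Plane) u₀ := by
    refine hF.differentiableAt.hasFDerivAt.congr_fderiv ?_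
    ext v : 1
    rfl
  let Ψ := hc.toOpenPartialHomeomorph F hD hn
  have hsymm : ContDiffAt ℝ ω Ψ.symm (F u₀) := hc.to_localInverse hD hn
  have hmem : u₀ ∈ Ψ.source := hc.mem_toOpenPartialHomeomorph_source hD hn
  -- The source is cut down to the points where both the map and its inverse are analytic; a priori
  -- this is known only at the base point.
  have hev : ∀ᶠ u in 𝓝 u₀, AnalyticAt ℝ F u ∧ AnalyticAt ℝ Ψ.symm (F u) :=
    hF.eventually_analyticAt.and
      (hF.continuousAt.eventually hsymm.analyticAt.eventually_analyticAt)
  set s : Set Plane := {u | AnalyticAt ℝ F u ∧ AnalyticAt ℝ Ψ.symm (F u)} with hs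
  refine ⟨Ψ.restr s, ⟨?_, rfl, ?_, ?_⟩, fun u => rfl⟩
  · rw [OpenPartialHomeomorph.restr_source]
    exact ⟨hmem, mem_interior_iff_mem_nhds.2 hev⟩
  · refine contMDiffOn_iff_contDiffOn.2 fun u hu => ?_
    rw [OpenPartialHomeomorph.restr_source] at hu
    exact (interior_subset hu.2).1.contDiffAt.contDiffWithinAt
  · refine contMDiffOn_iff_contDiffOn.2 fun u hu => ?_
    have h1 := (Ψ.restr s).map_target hu
    rw [OpenPartialHomeomorph.restr_source] at h1
    have h2 := (interior_subset h1.2).2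
    have h3 : F ((Ψ.restr s).symm u) = u := (Ψ.restr s).right_inv hu
    rw [h3] at h2
    exact h2.contDiffAt.contDiffWithinAt

theorem IsLocalAnalyticDiffeo.restr {Φ : OpenPartialHomeomorph M N} {p : M} {p' : N}
    (h : IsLocalAnalyticDiffeo Φ p p') {s : Set M} (hs : s ∈ 𝓝 p) :
    IsLocalAnalyticDiffeo (Φ.restr s) p p' where
  mem_source := by
    rw [OpenPartialHomeomorph.restr_source]
    exact ⟨h.mem_source, mem_interior_iff_mem_nhds.2 hs⟩
  map_point := h.map_point
  analytic := h.analytic.mono (by rw [OpenPartialHomeomorph.restr_source]; exact Set.inter_subset_left)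
  analytic_symm := h.analytic_symm.mono fun _ hu => hu.1

theorem IsLocalAnalyticDiffeo.trans {Φ : OpenPartialHomeomorph M N}
    {Ψ : OpenPartialHomeomorph N P} {p : M} {p' : N} {p'' : P}
    (h : IsLocalAnalyticDiffeo Φ p p') (h' : IsLocalAnalyticDiffeo Ψ p' p'') :
    IsLocalAnalyticDiffeo (Φ.trans Ψ) p p'' where
  mem_source := by
    rw [OpenPartialHomeomorph.trans_source]
    exact ⟨h.mem_source, by rw [Set.mem_preimage, h.map_point]; exact h'.mem_source⟩
  map_point := by rw [OpenPartialHomeomorph.coe_trans, Function.comp_apply, h.map_point, h'.map_point]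
  analytic := by
    rw [OpenPartialHomeomorph.coe_trans, OpenPartialHomeomorph.trans_source]
    exact h'.analytic.comp (h.analytic.mono Set.inter_subset_left) fun _ hu => hu.2
  analytic_symm := by
    rw [OpenPartialHomeomorph.coe_trans_symm, OpenPartialHomeomorph.trans_target]
    exact h.analytic_symm.comp (h'.analytic_symm.mono Set.inter_subset_left) fun _ hu => hu.2

theorem IsLocalAnalyticDiffeo.contMDiffAt {Φ : OpenPartialHomeomorph M N} {p : M} {p' : N}
    (h : IsLocalAnalyticDiffeo Φ p p') {q : M} (hq : q ∈ Φ.source) :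
    ContMDiffAt (𝓡 2) (𝓡 2) ω Φ q :=
  h.analytic.contMDiffAt (Φ.open_source.mem_nhds hq)

theorem IsLocalAnalyticDiffeo.contMDiffAt_symm {Φ : OpenPartialHomeomorph M N} {p : M} {p' : N}
    (h : IsLocalAnalyticDiffeo Φ p p') {q : N} (hq : q ∈ Φ.target) :
    ContMDiffAt (𝓡 2) (𝓡 2) ω Φ.symm q :=
  h.analytic_symm.contMDiffAt (Φ.open_target.mem_nhds hq)

theorem IsLocalAnalyticDiffeo.mdifferentiableAt {Φ : OpenPartialHomeomorph M N} {p : M} {p' : N}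
    (h : IsLocalAnalyticDiffeo Φ p p') {q : M} (hq : q ∈ Φ.source) :
    MDifferentiableAt (𝓡 2) (𝓡 2) Φ q :=
  (h.contMDiffAt hq).mdifferentiableAt (by simp)

theorem PairEquiv.trans {L : OpField M} {e : VField M} {p : M} {L' : OpField N} {e' : VField N}
    {p' : N} {L'' : OpField P} {e'' : VField P} {p'' : P} (h : PairEquiv L e p L' e' p')
    (h' : PairEquiv L' e' p' L'' e'' p'') : PairEquiv L e p L'' e'' p'' := by
  obtain ⟨Φ, hΦ, hL, he⟩ := h
  obtain ⟨Ψ, hΨ, hL', he'⟩ := h'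
  refine ⟨Φ.trans Ψ, hΦ.trans hΨ, fun q hq v => ?_, fun q hq => ?_⟩
  all_goals
    rw [OpenPartialHomeomorph.trans_source] at hq
    have hc : mfderiv (𝓡 2) (𝓡 2) (Φ.trans Ψ) q =
        (mfderiv (𝓡 2) (𝓡 2) Ψ (Φ q)).comp (mfderiv (𝓡 2) (𝓡 2) Φ q) :=
      mfderiv_comp q (hΨ.mdifferentiableAt hq.2) (hΦ.mdifferentiableAt hq.1)
    rw [hc]
  · change mfderiv (𝓡 2) (𝓡 2) Ψ (Φ q) (mfderiv (𝓡 2) (𝓡 2) Φ q (L q v)) = _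
    rw [hL q hq.1, hL' _ hq.2]
    rfl
  · change mfderiv (𝓡 2) (𝓡 2) Ψ (Φ q) (mfderiv (𝓡 2) (𝓡 2) Φ q (e q)) = _
    rw [he q hq.1, he' _ hq.2]
    rfl

/-- An analytic map of the plane with invertible derivative which intertwines two operator
fields near a point defines a local equivalence of these operator fields. -/
theorem OpEquiv.of_eventually {L L' : OpField Plane} {F : Plane → Plane} {u₀ u₁ : Plane}
    (hF : AnalyticAt ℝ F u₀) (hu : F u₀ = u₁) (hinj : ∀ v, fderiv ℝ F u₀ v = 0 → v = 0)
    (hL : ∀ᶠ u in 𝓝 u₀, ∀ v : Plane, fderiv ℝ F u (L u v) = L' (F u) (fderiv ℝ F u v)) :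
    OpEquiv L u₀ L' u₁ := by
  obtain ⟨Φ, hΦ, hΦF⟩ := exists_isLocalAnalyticDiffeo hF hinj
  obtain rfl : (Φ : Plane → Plane) = F := funext hΦF
  rw [hu] at hΦ
  refine ⟨Φ.restr _, hΦ.restr hL, fun u hu v => ?_⟩
  rw [OpenPartialHomeomorph.restr_source] at hu
  have := interior_subset hu.2 v
  rw [← mfderiv_eq_fderiv] at this
  exact this

theorem PairEquiv.of_eventually {L L' : OpField Plane} {e e' : VField Plane} {F : Plane → Plane}
    {u₀ u₁ : Plane}
    (hF : AnalyticAt ℝ F u₀) (hu : F u₀ = u₁) (hinj : ∀ v, fderiv ℝ F u₀ v = 0 → v = 0)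
    (hL : ∀ᶠ u in 𝓝 u₀, ∀ v : Plane, fderiv ℝ F u (L u v) = L' (F u) (fderiv ℝ F u v))
    (he : ∀ᶠ u in 𝓝 u₀, fderiv ℝ F u (e u) = e' (F u)) :
    PairEquiv L e u₀ L' e' u₁ := by
  obtain ⟨Φ, hΦ, hΦF⟩ := exists_isLocalAnalyticDiffeo hF hinj
  obtain rfl : (Φ : Plane → Plane) = F := funext hΦF
  rw [hu] at hΦ
  refine ⟨Φ.restr _, hΦ.restr (hL.and he), fun u hu v => ?_, fun u hu => ?_⟩
  all_goals
    rw [OpenPartialHomeomorph.restr_source] at hu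
    have := interior_subset hu.2
    simp only [Set.mem_ofPred_eq, ← mfderiv_eq_fderiv] at this
  · exact this.1 v
  · exact this.2

end Equiv

/-! ### First integrals -/

/-- Flow box: flowing out of a line transversal to `e` gives coordinates (time, position on the
line), and the position is constant along `e`. -/
theorem exists_first_integral {e : Plane → Plane} {u₀ : Plane} (he : AnalyticAt ℝ e u₀)
    (he0 : e u₀ ≠ 0) :
    ∃ J : Plane → ℝ, AnalyticAt ℝ J u₀ ∧ J u₀ = 0 ∧ fderiv ℝ J u₀ ≠ 0 ∧
      ∀ᶠ u in 𝓝 u₀, fderiv ℝ J u (e u) = 0 := by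
  obtain ⟨Y, hY, hY0, hYd⟩ := exists_analytic_flow he
  -- `n` is `e u₀` turned by a right angle, so `e u₀` and `n` have determinant `|e u₀|²`.
  set n : Plane := !₂[-(e u₀ 1), e u₀ 0] with hn
  let ι : Plane → ℝ × Plane := fun z => (z 0, u₀ + z 1 • n)
  let A : Plane →L[ℝ] ℝ × Plane := (coord 0).prod ((coord 1).smulRight n)
  have hι : ∀ z, HasFDerivAt ι A z := fun z =>
    (coord 0).hasFDerivAt.prodMk (((coord 1).smulRight n).hasFDerivAt.const_add u₀)
  have hιa : AnalyticAt ℝ ι 0 := ((coord 0).analyticAt _).prod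
    (analyticAt_const.add (((coord 1).smulRight n).analyticAt _))
  have hι0 : ι 0 = (0, u₀) := by simp [ι]
  rw [← hι0] at hY hYd
  let F : Plane → Plane := fun z => Y (ι z)
  have hF : AnalyticAt ℝ F 0 := AnalyticAt.fun_comp (g := Y) (f := ι) hY hιa
  have hF0 : F 0 = u₀ := by simp only [F, hι0]; exact hY0.self_of_nhds
  have hFd : ∀ z, DifferentiableAt ℝ Y (ι z) → fderiv ℝ F z = (fderiv ℝ Y (ι z)).comp A :=
    fun z hz => (hz.hasFDerivAt.comp z (hι z)).fderiv
  have hYt : ∀ z : ℝ × Plane, DifferentiableAt ℝ Y z →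
      HasDerivAt (fun t => Y (t, z.2)) (e (Y z)) z.1 → fderiv ℝ Y z (1, 0) = e (Y z) := by
    intro z hz hd
    have h1 : HasDerivAt (fun t : ℝ => (t, z.2)) ((1 : ℝ), (0 : Plane)) z.1 :=
      (hasDerivAt_id _).prodMk (hasDerivAt_const _ _)
    exact (hz.hasFDerivAt.comp_hasDerivAt (f := fun t : ℝ => (t, z.2)) z.1 h1).unique hd
  have hYw : ∀ w, fderiv ℝ Y (ι 0) (0, w) = w := by
    intro w
    have h1 : HasFDerivAt (fun w : Plane => ((0 : ℝ), w)) (.inr ℝ ℝ Plane) u₀ :=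
      (ContinuousLinearMap.inr ℝ ℝ Plane).hasFDerivAt
    have h2 : HasFDerivAt (fun w : Plane => Y (0, w)) ((fderiv ℝ Y (ι 0)).comp (.inr ℝ ℝ Plane)) u₀ := by
      refine HasFDerivAt.comp (g := Y) (f := fun w : Plane => ((0 : ℝ), w)) u₀ ?_ h1
      rw [← hι0]
      exact hY.differentiableAt.hasFDerivAt
    have h3 : HasFDerivAt (fun w : Plane => Y (0, w)) (.id ℝ Plane) u₀ :=
      (hasFDerivAt_id u₀).congr_of_eventuallyEq hY0
    exact congrArg (fun A : Plane →L[ℝ] Plane => A w) (h2.unique h3)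
  have hF' : ∀ v, fderiv ℝ F 0 v = v 0 • e u₀ + v 1 • n := by
    intro v
    rw [hFd 0 hY.differentiableAt]
    have : A v = v 0 • ((1 : ℝ), (0 : Plane)) + ((0 : ℝ), v 1 • n) := by
      simp [A]
    rw [ContinuousLinearMap.comp_apply, this, map_add, map_smul, hYw,
      hYt _ hY.differentiableAt hYd.self_of_nhds]
    congr 2
    exact congrArg e hF0
  have hinj : ∀ v, fderiv ℝ F 0 v = 0 → v = 0 := by
    intro v hv
    rw [hF'] at hv
    have h0 := congrArg (fun u : Plane => u 0) hv
    have h1 := congrArg (fun u : Plane => u 1) hv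
    simp [n] at h0 h1
    have hpos : 0 < e u₀ 0 ^ 2 + e u₀ 1 ^ 2 := by
      by_contra hcon
      refine he0 (plane_ext ?_ ?_)
      · simp only [PiLp.zero_apply]; nlinarith [sq_nonneg (e u₀ 0), sq_nonneg (e u₀ 1)]
      · simp only [PiLp.zero_apply]; nlinarith [sq_nonneg (e u₀ 0), sq_nonneg (e u₀ 1)]
    refine plane_ext ?_ ?_
    · have : v 0 * (e u₀ 0 ^ 2 + e u₀ 1 ^ 2) = 0 := by linear_combination e u₀ 0 * h0 + e u₀ 1 * h1
      simpa [hpos.ne'] using this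
    · have : v 1 * (e u₀ 0 ^ 2 + e u₀ 1 ^ 2) = 0 := by linear_combination e u₀ 0 * h1 - e u₀ 1 * h0
      simpa [hpos.ne'] using this
  obtain ⟨Φ, hΦ, hΦF⟩ := exists_isLocalAnalyticDiffeo hF hinj
  rw [hF0] at hΦ
  have hmem : u₀ ∈ Φ.target := by rw [← hΦ.map_point]; exact Φ.map_source hΦ.mem_source
  have hsa : ∀ u ∈ Φ.target, AnalyticAt ℝ Φ.symm u := fun u hu =>
    (contMDiffAt_iff_contDiffAt.1 (hΦ.contMDiffAt_symm hu)).analyticAt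
  have hs0 : Φ.symm u₀ = 0 := by rw [← hΦ.map_point]; exact Φ.left_inv hΦ.mem_source
  let J : Plane → ℝ := fun u => Φ.symm u 1
  have hJa : ∀ u ∈ Φ.target, AnalyticAt ℝ J u := fun u hu => analyticAt_coord (hsa u hu) 1
  have hFa : ∀ z ∈ Φ.source, DifferentiableAt ℝ F z := fun z hz => by
    have := (contMDiffAt_iff_contDiffAt.1 (hΦ.contMDiffAt hz)).analyticAt.differentiableAt
    exact (funext hΦF : (Φ : Plane → Plane) = F) ▸ this
  -- `J ∘ F` is the second coordinate. As `F` sends the first coordinate vector to `e`, this will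
  -- give `dJ(e) = 0`.
  have hJF : ∀ z ∈ Φ.source, ∀ v, fderiv ℝ J (F z) (fderiv ℝ F z v) = v 1 := by
    intro z hz v
    have hzt : F z ∈ Φ.target := by rw [← hΦF]; exact Φ.map_source hz
    have h1 := (hJa _ hzt).differentiableAt.hasFDerivAt.comp z (hFa z hz).hasFDerivAt
    have h2 : HasFDerivAt (J ∘ F) (coord 1) z := by
      refine (coord 1).hasFDerivAt.congr_of_eventuallyEq ?_
      filter_upwards [Φ.open_source.mem_nhds hz] with z' hz'
      simp only [Function.comp_apply, J, ← hΦF, Φ.left_inv hz', coord_apply]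
    exact congrArg (fun A : Plane →L[ℝ] ℝ => A v) (h1.unique h2)
  refine ⟨J, hJa u₀ hmem, by simp [J, hs0], ?_, ?_⟩
  · intro h0
    have := hJF 0 hΦ.mem_source !₂[0, 1]
    rw [hF0, h0] at this
    simp at this
  · have hev : ∀ᶠ z in 𝓝 (0 : Plane), DifferentiableAt ℝ Y (ι z) ∧
        HasDerivAt (fun t => Y (t, (ι z).2)) (e (Y (ι z))) (ι z).1 :=
      hιa.continuousAt.eventually ((hY.eventually_analyticAt.mono fun _ h => h.differentiableAt).and hYd)
    rw [← hs0] at hev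
    filter_upwards [(hsa u₀ hmem).continuousAt.eventually hev, Φ.open_target.mem_nhds hmem] with u h hu
    have h1 := hJF _ (Φ.map_target hu) !₂[1, 0]
    have h2 : F (Φ.symm u) = u := by rw [← hΦF]; exact Φ.right_inv hu
    have h3 : A !₂[1, 0] = ((1 : ℝ), (0 : Plane)) := by simp [A]
    rw [hFd _ h.1, ContinuousLinearMap.comp_apply, h3, hYt _ h.1 h.2] at h1
    change fderiv ℝ J (F (Φ.symm u)) (e (F (Φ.symm u))) = _ at h1
    rw [h2] at h1
    simpa using h1

/-! ### Torsion and Lie derivative in coordinates -/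

section Coordinates

/-- The first coordinate vector of the plane. -/
abbrev ex : Plane := !₂[1, 0]

/-- The second coordinate vector of the plane. -/
abbrev ey : Plane := !₂[0, 1]

theorem eq_smul_add_smul (v : Plane) : v = v 0 • ex + v 1 • ey := by
  refine plane_ext ?_ ?_ <;> simp

theorem clm_eq_smulRight {G : Type*} [NormedAddCommGroup G] [NormedSpace ℝ G] (A : Plane →L[ℝ] G) :
    A = (coord 0).smulRight (A ex) + (coord 1).smulRight (A ey) := by
  ext v
  conv_lhs => rw [eq_smul_add_smul v, map_add, map_smul, map_smul]
  simp

theorem analyticAt_clm {E : Type*} [NormedAddCommGroup E] [NormedSpace ℝ E]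
    {L : E → Plane →L[ℝ] Plane} {z : E} (hx : AnalyticAt ℝ (fun z => L z ex) z)
    (hy : AnalyticAt ℝ (fun z => L z ey) z) : AnalyticAt ℝ L z := by
  have h : AnalyticAt ℝ (fun z => ContinuousLinearMap.smulRightL ℝ Plane Plane (coord 0) (L z ex) +
      ContinuousLinearMap.smulRightL ℝ Plane Plane (coord 1) (L z ey)) z :=
    ((ContinuousLinearMap.analyticAt _ _).fun_comp hx).add
      ((ContinuousLinearMap.analyticAt _ _).fun_comp hy)
  exact h.congr (.of_forall fun z => (clm_eq_smulRight (L z)).symm)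

theorem fderiv_clm_apply_const {L : Plane → Plane →L[ℝ] Plane} {u : Plane}
    (hL : DifferentiableAt ℝ L u) (v w : Plane) :
    fderiv ℝ L u v w = fderiv ℝ (fun u => L u w) u v := by
  have h := hL.hasFDerivAt.clm_apply (hasFDerivAt_const w u)
  rw [h.fderiv]; simp

/-- The Nijenhuis torsion of an operator field on the plane, in terms of its derivative. -/
def coordTorsion (L : Plane → Plane →L[ℝ] Plane) (u v w : Plane) : Plane :=
  fderiv ℝ L u (L u v) w - fderiv ℝ L u (L u w) v - L u (fderiv ℝ L u v w)
    + L u (fderiv ℝ L u w v)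

/-- The Lie derivative of an operator field on the plane, in terms of derivatives. -/
def coordLieDeriv (e : Plane → Plane) (L : Plane → Plane →L[ℝ] Plane) (u v : Plane) : Plane :=
  fderiv ℝ L u (e u) v - fderiv ℝ e u (L u v) + L u (fderiv ℝ e u v)

theorem mlieBracket_plane (ξ η : Plane → Plane) (u : Plane) :
    VectorField.mlieBracket (𝓡 2) (ξ : VField Plane) (η : VField Plane) u =
      fderiv ℝ η u (ξ u) - fderiv ℝ ξ u (η u) :=
  (congrFun VectorField.mlieBracketWithin_univ.symm u).trans <|
    (congrFun VectorField.mlieBracketWithin_eq_lieBracketWithin u).trans <|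
      congrFun (VectorField.lieBracketWithin_univ (𝕜 := ℝ) (V := ξ) (W := η)) u

theorem fderiv_app {L : Plane → Plane →L[ℝ] Plane} {ξ : Plane → Plane} {u : Plane}
    (hL : DifferentiableAt ℝ L u) (hξ : DifferentiableAt ℝ ξ u) (v : Plane) :
    fderiv ℝ (fun u => L u (ξ u)) u v = fderiv ℝ L u v (ξ u) + L u (fderiv ℝ ξ u v) := by
  rw [(hL.hasFDerivAt.clm_apply hξ.hasFDerivAt).fderiv]
  simp [add_comm]

/-- The torsion is a tensor: the terms with derivatives of `ξ` and `η` cancel, and only derivatives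
of `L` remain. -/
theorem torsion_plane {L : Plane → Plane →L[ℝ] Plane} {ξ η : Plane → Plane} {u : Plane}
    (hL : DifferentiableAt ℝ L u) (hξ : DifferentiableAt ℝ ξ u) (hη : DifferentiableAt ℝ η u) :
    torsion (M := Plane) L ξ η u = coordTorsion L u (ξ u) (η u) := by
  obtain ⟨B₁, h1⟩ : ∃ B : Plane, B = VectorField.mlieBracket (𝓡 2)
    (fun u => L u (ξ u) : VField Plane) (fun u => L u (η u) : VField Plane) u := ⟨_, rfl⟩
  obtain ⟨B₂, h2⟩ : ∃ B : Plane, B = VectorField.mlieBracket (𝓡 2)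
    (ξ : VField Plane) (η : VField Plane) u := ⟨_, rfl⟩
  obtain ⟨B₃, h3⟩ : ∃ B : Plane, B = VectorField.mlieBracket (𝓡 2)
    (fun u => L u (ξ u) : VField Plane) (η : VField Plane) u := ⟨_, rfl⟩
  obtain ⟨B₄, h4⟩ : ∃ B : Plane, B = VectorField.mlieBracket (𝓡 2)
    (ξ : VField Plane) (fun u => L u (η u) : VField Plane) u := ⟨_, rfl⟩
  have h : torsion (M := Plane) L ξ η u = B₁ + L u (L u B₂) - L u B₃ - L u B₄ := by
    rw [h1, h2, h3, h4]; rfl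
  replace h1 := h1.trans (mlieBracket_plane (fun u => L u (ξ u)) (fun u => L u (η u)) u)
  replace h2 := h2.trans (mlieBracket_plane ξ η u)
  replace h3 := h3.trans (mlieBracket_plane (fun u => L u (ξ u)) η u)
  replace h4 := h4.trans (mlieBracket_plane ξ (fun u => L u (η u)) u)
  rw [fderiv_app hL hξ, fderiv_app hL hη] at h1
  rw [fderiv_app hL hξ] at h3
  rw [fderiv_app hL hη] at h4
  refine h.trans ?_
  rw [h1, h2, h3, h4, coordTorsion]
  simp only [map_sub, map_add]
  abel

theorem lieDerivOp_plane {L : Plane → Plane →L[ℝ] Plane} {e ξ : Plane → Plane} {u : Plane}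
    (hL : DifferentiableAt ℝ L u) (hξ : DifferentiableAt ℝ ξ u) :
    lieDerivOp (M := Plane) e L ξ u = coordLieDeriv e L u (ξ u) := by
  obtain ⟨B₂, h2⟩ : ∃ B : Plane, B = VectorField.mlieBracket (𝓡 2)
    (e : VField Plane) (ξ : VField Plane) u := ⟨_, rfl⟩
  obtain ⟨B₄, h4⟩ : ∃ B : Plane, B = VectorField.mlieBracket (𝓡 2)
    (e : VField Plane) (fun u => L u (ξ u) : VField Plane) u := ⟨_, rfl⟩
  have h : lieDerivOp (M := Plane) e L ξ u = B₄ - L u B₂ := by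
    rw [h2, h4]; rfl
  replace h2 := h2.trans (mlieBracket_plane e ξ u)
  replace h4 := h4.trans (mlieBracket_plane e (fun u => L u (ξ u)) u)
  rw [fderiv_app hL hξ] at h4
  refine h.trans ?_
  rw [h2, h4, coordLieDeriv]
  simp only [map_sub]
  abel

theorem AnalyticVFieldAt.differentiableAt {ξ : Plane → Plane} {u : Plane}
    (h : AnalyticVFieldAt (M := Plane) ξ u) : DifferentiableAt ℝ ξ u :=
  (contMDiffAt_vectorSpace_iff_contDiffAt.1 h).differentiableAt (by simp)

end Coordinates

/-! ### The model operators -/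

section Models

theorem toEuclideanCLM_apply (A : Matrix (Fin 2) (Fin 2) ℝ) (v : Plane) :
    Matrix.toEuclideanCLM (n := Fin 2) (𝕜 := ℝ) A v =
      !₂[A 0 0 * v 0 + A 0 1 * v 1, A 1 0 * v 0 + A 1 1 * v 1] := by
  have h : Matrix.toEuclideanCLM (n := Fin 2) (𝕜 := ℝ) A v = WithLp.toLp 2 (A.mulVec v) := rfl
  rw [h]
  refine plane_ext ?_ ?_ <;> simp [Matrix.mulVec, dotProduct, Fin.sum_univ_two]

/-- The operator with the matrix `(l + x, b(y); c(y), l + x)`. -/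
def normalOp (l : ℝ) (b c : ℝ → ℝ) : Plane → Plane →L[ℝ] Plane := fun u =>
  Matrix.toEuclideanCLM (n := Fin 2) (𝕜 := ℝ) !![l + u 0, b (u 1); c (u 1), l + u 0]

theorem normalOp_apply (l : ℝ) (b c : ℝ → ℝ) (u v : Plane) : normalOp l b c u v =
    !₂[(l + u 0) * v 0 + b (u 1) * v 1, c (u 1) * v 0 + (l + u 0) * v 1] := by
  rw [normalOp, toEuclideanCLM_apply]; rfl

theorem opOfMatrix_eq_normalOp {l : ℝ} {b c : ℝ → ℝ} {A : ℝ → ℝ → Matrix (Fin 2) (Fin 2) ℝ}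
    (h : ∀ x y, A x y = !![l + x, b y; c y, l + x]) : opOfMatrix A = normalOp l b c := by
  funext u
  exact congrArg (Matrix.toEuclideanCLM (n := Fin 2) (𝕜 := ℝ)) (h (u 0) (u 1))

theorem form₁_eq (l : ℝ) : form₁ l = normalOp l 0 0 :=
  opOfMatrix_eq_normalOp fun _ _ => rfl

theorem form₂_eq (l d : ℝ) :
    form₂ l d = normalOp l (fun _ => -(1 / 2)) (fun y => 2 * (y + d)) :=
  opOfMatrix_eq_normalOp fun x y => by ext i j; fin_cases i <;> fin_cases j <;> simp

theorem form₃_eq (l s : ℝ) (k : ℕ) : form₃ l s k =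
    normalOp l (fun y => -s * ((k : ℝ) / 2) * y ^ (k - 1)) (fun y => (2 / (k : ℝ)) * y) :=
  opOfMatrix_eq_normalOp fun x y => by ext i j; fin_cases i <;> fin_cases j <;> simp

theorem form₄_eq (l : ℝ) (g : ℝ → ℝ) : form₄ l (fun z => g z.2) = normalOp l 0 g :=
  opOfMatrix_eq_normalOp fun x y => by ext i j; fin_cases i <;> fin_cases j <;> simp

theorem form₄_apply (l : ℝ) (f : ℝ × ℝ → ℝ) (u v : Plane) : form₄ l f u v =
    (!₂[(l + u 0) * v 0, f (u 0, u 1) * v 0 + (l + u 0) * v 1] : Plane) := by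
  refine (toEuclideanCLM_apply _ v).trans ?_
  refine plane_ext ?_ ?_ <;> simp

theorem hasFDerivAt_coord (i : Fin 2) (u : Plane) :
    HasFDerivAt (fun u : Plane => u i) (coord i) u := (coord i).hasFDerivAt

theorem hasFDerivAt_comp_coord {b : ℝ → ℝ} {i : Fin 2} {u : Plane}
    (hb : DifferentiableAt ℝ b (u i)) :
    HasFDerivAt (fun u : Plane => b (u i)) (deriv b (u i) • coord i) u :=
  hb.hasDerivAt.comp_hasFDerivAt u (hasFDerivAt_coord i u)

theorem analyticAt_comp_coord {b : ℝ → ℝ} {i : Fin 2} {u : Plane} (hb : AnalyticAt ℝ b (u i)) :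
    AnalyticAt ℝ (fun u : Plane => b (u i)) u :=
  AnalyticAt.fun_comp (g := b) (f := coord i) hb ((coord i).analyticAt u)

theorem analyticAt_normalOp {l : ℝ} {b c : ℝ → ℝ} {u : Plane} (hb : AnalyticAt ℝ b (u 1))
    (hc : AnalyticAt ℝ c (u 1)) :
    AnalyticAt ℝ (normalOp l b c) u := by
  have hx : AnalyticAt ℝ (fun u : Plane => l + u 0) u :=
    analyticAt_const.add ((coord 0).analyticAt u)
  refine analyticAt_clm ?_ ?_
  · refine (analyticAt_mk hx (analyticAt_comp_coord hc)).congr (.of_forall fun z => ?_)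
    simp only [normalOp_apply]
    simp
  · refine (analyticAt_mk (analyticAt_comp_coord hb) hx).congr (.of_forall fun z => ?_)
    simp only [normalOp_apply]
    simp

theorem fderiv_normalOp {l : ℝ} {b c : ℝ → ℝ} {u : Plane} (hb : AnalyticAt ℝ b (u 1))
    (hc : AnalyticAt ℝ c (u 1)) (v w : Plane) :
    fderiv ℝ (normalOp l b c) u v w =
      !₂[v 0 * w 0 + deriv b (u 1) * v 1 * w 1, deriv c (u 1) * v 1 * w 0 + v 0 * w 1] := by
  rw [fderiv_clm_apply_const (analyticAt_normalOp hb hc).differentiableAt]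
  simp only [normalOp_apply]
  have hx : HasFDerivAt (fun u : Plane => l + u 0) (coord 0) u := (hasFDerivAt_coord 0 u).const_add l
  have h1 := (hx.mul_const (w 0)).add ((hasFDerivAt_comp_coord hb.differentiableAt).mul_const (w 1))
  have h2 := ((hasFDerivAt_comp_coord hc.differentiableAt).mul_const (w 0)).add (hx.mul_const (w 1))
  have h := fderiv_mk h1.differentiableAt h2.differentiableAt v
  rw [h1.fderiv, h2.fderiv] at h
  refine h.trans ?_
  refine plane_ext ?_ ?_ <;> simp <;> ring

/-- The second component of the torsion on `(v, w)` vanishes identically, and the first is `(v₀w₁ -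
v₁w₀)((bc)' - 2b)`. The unity condition is just `∂_x L = Id`. -/
theorem isModelNearZero_normalOp {l : ℝ} {b c : ℝ → ℝ} (hb : AnalyticAt ℝ b 0)
    (hc : AnalyticAt ℝ c 0)
    (h : ∀ᶠ y in 𝓝 0, deriv b y * c y + b y * deriv c y = 2 * b y) :
    IsModelNearZero (normalOp l b c) := by
  have hcont : ContinuousAt (fun u : Plane => u 1) 0 := (coord 1).continuous.continuousAt
  filter_upwards [hcont.eventually hb.eventually_analyticAt,
    hcont.eventually hc.eventually_analyticAt, hcont.eventually h] with u hbu hcu hu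
  have hL := (analyticAt_normalOp (l := l) hbu hcu).differentiableAt
  have hT : ∀ v w : Plane, coordTorsion (normalOp l b c) u v w = 0 := by
    intro v w
    simp only [coordTorsion, fderiv_normalOp hbu hcu, normalOp_apply]
    refine plane_ext ?_ ?_
    · simp
      linear_combination (v 0 * w 1 - v 1 * w 0) * hu
    · simp
      ring
  have hU : ∀ v : Plane, coordLieDeriv (fun _ => ex) (normalOp l b c) u v = v := by
    intro v
    simp only [coordLieDeriv, fderiv_normalOp hbu hcu, fderiv_fun_const]
    refine plane_ext ?_ ?_ <;> simp
  exact ⟨fun ξ η hξ hη => (torsion_plane hL (AnalyticVFieldAt.differentiableAt hξ)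
      (AnalyticVFieldAt.differentiableAt hη)).trans (hT _ _),
    fun ξ hξ => (lieDerivOp_plane hL (AnalyticVFieldAt.differentiableAt hξ)).trans (hU _)⟩

end Models

/-! ### Transport of a Nijenhuis operator to the plane -/

section Push

variable {M : Type*} [TopologicalSpace M] [ChartedSpace Plane M]

/-- The differential of a coordinate system, all tangent spaces being identified with the
plane. -/
def dmap (Φ : OpenPartialHomeomorph M Plane) (q : M) : Plane →L[ℝ] Plane :=
  mfderiv (𝓡 2) (𝓡 2) Φ q

/-- The differential of the inverse of a coordinate system. -/
def dsymm (Φ : OpenPartialHomeomorph M Plane) (u : Plane) : Plane →L[ℝ] Plane :=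
  mfderiv (𝓡 2) (𝓡 2) Φ.symm u

/-- An operator field, all tangent spaces being identified with the plane. -/
def planeOp (L : OpField M) (q : M) : Plane →L[ℝ] Plane := L q

/-- A vector field, all tangent spaces being identified with the plane. -/
def planeVec (ξ : VField M) (q : M) : Plane := ξ q

/-- An operator field in local coordinates. -/
def pushOp (Φ : OpenPartialHomeomorph M Plane) (L : OpField M) (u : Plane) : Plane →L[ℝ] Plane :=
  (dmap Φ (Φ.symm u)).comp ((planeOp L (Φ.symm u)).comp (dsymm Φ u))

/-- A vector field in local coordinates. -/
def pushField (Φ : OpenPartialHomeomorph M Plane) (ξ : VField M) (u : Plane) : Plane :=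
  dmap Φ (Φ.symm u) (planeVec ξ (Φ.symm u))

variable {Φ : OpenPartialHomeomorph M Plane} {p : M} {u₀ : Plane}

theorem IsLocalAnalyticDiffeo.mDifferentiable (h : IsLocalAnalyticDiffeo Φ p u₀) :
    Φ.MDifferentiable (𝓡 2) (𝓡 2) :=
  ⟨h.analytic.mdifferentiableOn (by simp), h.analytic_symm.mdifferentiableOn (by simp)⟩

theorem dmap_dsymm [IsManifold (𝓡 2) ω M] (h : IsLocalAnalyticDiffeo Φ p u₀) {u : Plane}
    (hu : u ∈ Φ.target) (v : Plane) :
    dmap Φ (Φ.symm u) (dsymm Φ u v) = v :=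
  congrArg (fun A : Plane →L[ℝ] Plane => A v) (h.mDifferentiable.comp_symm_deriv hu)

theorem dsymm_apply_dmap [IsManifold (𝓡 2) ω M] (h : IsLocalAnalyticDiffeo Φ p u₀) {q : M}
    (hq : q ∈ Φ.source) (v : Plane) : dsymm Φ (Φ q) (dmap Φ q v) = v :=
  congrArg (fun A : Plane →L[ℝ] Plane => A v) (h.mDifferentiable.symm_comp_deriv hq)

theorem dsymm_dmap [IsManifold (𝓡 2) ω M] (h : IsLocalAnalyticDiffeo Φ p u₀) {u : Plane}
    (hu : u ∈ Φ.target) (v : Plane) :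
    dsymm Φ u (dmap Φ (Φ.symm u) v) = v := by
  have := dsymm_apply_dmap h (Φ.map_target hu) v
  rwa [Φ.right_inv hu] at this

theorem mapsField_pushField (Φ : OpenPartialHomeomorph M Plane) (e : VField M) :
    MapsField Φ e (pushField Φ e) := by
  intro q hq
  have h1 : pushField Φ e (Φ q) = dmap Φ q (planeVec e q) := by
    rw [pushField, Φ.left_inv hq]
  exact h1.symm

variable [IsManifold (𝓡 2) ω M]

theorem mapsOp_pushOp (h : IsLocalAnalyticDiffeo Φ p u₀) (L : OpField M) :
    MapsOp Φ L (pushOp Φ L) := by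
  intro q hq v
  have h1 : ∀ v : Plane, pushOp Φ L (Φ q) (dmap Φ q v) = dmap Φ q (planeOp L q v) := fun v => by
    rw [pushOp, ContinuousLinearMap.comp_apply, ContinuousLinearMap.comp_apply,
      dsymm_apply_dmap h hq, Φ.left_inv hq]
  exact (h1 v).symm

theorem pushField_app (h : IsLocalAnalyticDiffeo Φ p u₀) (L : OpField M) (ξ : VField M)
    {u : Plane} (hu : u ∈ Φ.target) :
    pushField Φ (L.app ξ) u = pushOp Φ L u (pushField Φ ξ u) := by
  rw [pushOp, ContinuousLinearMap.comp_apply, ContinuousLinearMap.comp_apply, pushField, pushField,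
    dsymm_dmap h hu]
  rfl

theorem inverse_mfderiv_symm (h : IsLocalAnalyticDiffeo Φ p u₀) {u : Plane} (hu : u ∈ Φ.target) :
    (dsymm Φ u).inverse = dmap Φ (Φ.symm u) := by
  refine ContinuousLinearMap.inverse_eq ?_ ?_
  · ext1 v; exact dsymm_dmap h hu v
  · ext1 v; exact dmap_dsymm h hu v

theorem inverse_mfderiv (h : IsLocalAnalyticDiffeo Φ p u₀) {u : Plane} (hu : u ∈ Φ.target) :
    (dmap Φ (Φ.symm u)).inverse = dsymm Φ u := by
  refine ContinuousLinearMap.inverse_eq ?_ ?_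
  · ext1 v; exact dmap_dsymm h hu v
  · ext1 v; exact dsymm_dmap h hu v

/-- Pushing forward by `Φ` is pulling back by its inverse, so analyticity and naturality of brackets
carry over from pullbacks. -/
theorem mpullback_symm_eq_pushField (h : IsLocalAnalyticDiffeo Φ p u₀) (ξ : VField M) {u : Plane}
    (hu : u ∈ Φ.target) :
    VectorField.mpullback (𝓡 2) (𝓡 2) Φ.symm ξ u = pushField Φ ξ u :=
  congrArg (fun A : Plane →L[ℝ] Plane => A (ξ (Φ.symm u))) (inverse_mfderiv_symm h hu)

theorem isInvertible_dsymm (h : IsLocalAnalyticDiffeo Φ p u₀) {u : Plane} (hu : u ∈ Φ.target) :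
    (mfderiv (𝓡 2) (𝓡 2) Φ.symm u).IsInvertible := by
  have : (dsymm Φ u).IsInvertible :=
    ContinuousLinearMap.IsInvertible.of_inverse (g := dmap Φ (Φ.symm u))
      (by ext1 v; exact dsymm_dmap h hu v) (by ext1 v; exact dmap_dsymm h hu v)
  exact this

theorem isInvertible_dmap (h : IsLocalAnalyticDiffeo Φ p u₀) {u : Plane} (hu : u ∈ Φ.target) :
    (mfderiv (𝓡 2) (𝓡 2) Φ (Φ.symm u)).IsInvertible := by
  have : (dmap Φ (Φ.symm u)).IsInvertible :=
    ContinuousLinearMap.IsInvertible.of_inverse (g := dsymm Φ u)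
      (by ext1 v; exact dmap_dsymm h hu v) (by ext1 v; exact dsymm_dmap h hu v)
  exact this

theorem analyticAt_pushField (h : IsLocalAnalyticDiffeo Φ p u₀) {ξ : VField M} {u : Plane}
    (hu : u ∈ Φ.target) (hξ : AnalyticVFieldAt ξ (Φ.symm u)) :
    AnalyticAt ℝ (pushField Φ ξ) u := by
  have : IsManifold (𝓡 2) 1 M := IsManifold.of_le (n := ω) le_top
  have h1 := ContMDiffAt.mpullback_vectorField_preimage (m := ω) (n := ω) hξ
    (h.contMDiffAt_symm hu) (isInvertible_dsymm h hu) (by simp)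
  have h2 : AnalyticAt ℝ (VectorField.mpullback (𝓡 2) (𝓡 2) Φ.symm ξ : Plane → Plane) u :=
    (contMDiffAt_vectorSpace_iff_contDiffAt.1 h1).analyticAt
  refine h2.congr ?_
  filter_upwards [Φ.open_target.mem_nhds hu] with z hz
  exact mpullback_symm_eq_pushField h ξ hz

theorem pushField_mlieBracket (h : IsLocalAnalyticDiffeo Φ p u₀) {ξ η : VField M} {u : Plane}
    (hu : u ∈ Φ.target) (hξ : AnalyticVFieldAt ξ (Φ.symm u)) (hη : AnalyticVFieldAt η (Φ.symm u)) :
    pushField Φ (VectorField.mlieBracket (𝓡 2) ξ η) u =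
      VectorField.mlieBracket (𝓡 2) (pushField Φ ξ : VField Plane) (pushField Φ η : VField Plane) u := by
  have : IsManifold (𝓡 2) (minSmoothness ℝ 2) M := IsManifold.of_le (n := ω) le_top
  have h1 := VectorField.mpullback_mlieBracket (n := ω) (f := Φ.symm) (x₀ := u)
    (hξ.mdifferentiableAt (by simp)) (hη.mdifferentiableAt (by simp)) (h.contMDiffAt_symm hu) le_top
  refine (mpullback_symm_eq_pushField h _ hu).symm.trans (h1.trans ?_)
  refine Filter.EventuallyEq.mlieBracket_vectorField_eq ?_ ?_
  · filter_upwards [Φ.open_target.mem_nhds hu] with z hz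
    exact mpullback_symm_eq_pushField h _ hz
  · filter_upwards [Φ.open_target.mem_nhds hu] with z hz
    exact mpullback_symm_eq_pushField h _ hz

theorem AnalyticOpField.app {L : OpField M} (hL : AnalyticOpField L) {ξ : VField M} {q : M}
    (hξ : AnalyticVFieldAt ξ q) : AnalyticVFieldAt (L.app ξ) q :=
  ContMDiffAt.clm_bundle_apply (F₁ := Plane) (F₂ := Plane) (b := fun q : M => q)
    (E₁ := fun q : M => TangentSpace (𝓡 2) q) (E₂ := fun q : M => TangentSpace (𝓡 2) q)
    (hL q) hξ

/-- Every vector is the value of a vector field which is constant in the given coordinates. -/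
theorem exists_pushField_eq (h : IsLocalAnalyticDiffeo Φ p u₀) {u : Plane} (hu : u ∈ Φ.target)
    (v : Plane) : ∃ ξ : VField M, AnalyticVFieldAt ξ (Φ.symm u) ∧
      ∀ z ∈ Φ.target, pushField Φ ξ z = v := by
  have : IsManifold (𝓡 2) 1 M := IsManifold.of_le (n := ω) le_top
  let ξ : VField M := VectorField.mpullback (𝓡 2) (𝓡 2) Φ (fun _ => v : VField Plane)
  have hv : ContMDiffAt (𝓡 2) (𝓡 2).tangent ω
      (fun z => (⟨z, v⟩ : TangentBundle (𝓡 2) Plane)) (Φ (Φ.symm u)) :=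
    contMDiffAt_vectorSpace_iff_contDiffAt.2 contDiffAt_const
  refine ⟨ξ, ContMDiffAt.mpullback_vectorField_preimage (m := ω) (n := ω) hv
    (h.contMDiffAt (Φ.map_target hu)) (isInvertible_dmap h hu) (by simp), fun z hz => ?_⟩
  have h1 : planeVec ξ (Φ.symm z) = dsymm Φ z v :=
    congrArg (fun A : Plane →L[ℝ] Plane => A v) (inverse_mfderiv h hz)
  have h2 := dmap_dsymm h hz v
  rw [← h1] at h2
  exact h2

/-- It suffices to test on constant coordinate fields. They come from analytic fields `ξ` on the
surface, for which `L ξ` is analytic. -/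
theorem analyticAt_pushOp (h : IsLocalAnalyticDiffeo Φ p u₀) {L : OpField M}
    (hL : AnalyticOpField L) {u : Plane} (hu : u ∈ Φ.target) : AnalyticAt ℝ (pushOp Φ L) u := by
  have key : ∀ v, AnalyticAt ℝ (fun z => pushOp Φ L z v) u := by
    intro v
    obtain ⟨ξ, hξ, hξv⟩ := exists_pushField_eq h hu v
    refine (analyticAt_pushField h hu (hL.app hξ)).congr ?_
    filter_upwards [Φ.open_target.mem_nhds hu] with z hz
    rw [pushField_app h L ξ hz, hξv z hz]
  exact analyticAt_clm (key _) (key _)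

theorem pushField_app_eventuallyEq (h : IsLocalAnalyticDiffeo Φ p u₀) (L : OpField M)
    (ξ : VField M) {u : Plane} (hu : u ∈ Φ.target) :
    pushField Φ (L.app ξ) =ᶠ[𝓝 u] fun z => pushOp Φ L z (pushField Φ ξ z) := by
  filter_upwards [Φ.open_target.mem_nhds hu] with z hz
  exact pushField_app h L ξ hz

/-- Naturality of the bracket, term by term. The formula for the pushforward of `L ξ` is needed only
near `u`, since a bracket depends on germs. -/
theorem torsion_pushOp (h : IsLocalAnalyticDiffeo Φ p u₀) {L : OpField M}
    (hL : AnalyticOpField L) {ξ η : VField M} {u : Plane} (hu : u ∈ Φ.target)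
    (hξ : AnalyticVFieldAt ξ (Φ.symm u)) (hη : AnalyticVFieldAt η (Φ.symm u)) :
    torsion (M := Plane) (pushOp Φ L) (pushField Φ ξ) (pushField Φ η) u =
      pushField Φ (torsion L ξ η) u := by
  have hξ' := pushField_app_eventuallyEq h L ξ hu
  have hη' := pushField_app_eventuallyEq h L η hu
  have rfl' : ∀ ζ : VField M, pushField Φ ζ =ᶠ[𝓝 u] pushField Φ ζ := fun ζ => .rfl
  have h1 := (pushField_mlieBracket h hu (hL.app hξ) (hL.app hη)).trans
    (Filter.EventuallyEq.mlieBracket_vectorField_eq (I := 𝓡 2) hξ' hη')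
  have h2 := pushField_mlieBracket h hu hξ hη
  have h3 := (pushField_mlieBracket h hu (hL.app hξ) hη).trans
    (Filter.EventuallyEq.mlieBracket_vectorField_eq (I := 𝓡 2) hξ' (rfl' η))
  have h4 := (pushField_mlieBracket h hu hξ (hL.app hη)).trans
    (Filter.EventuallyEq.mlieBracket_vectorField_eq (I := 𝓡 2) (rfl' ξ) hη')
  have h5 : ∀ ζ : VField M, pushOp Φ L u (pushField Φ ζ u) =
      dmap Φ (Φ.symm u) (planeOp L _ (planeVec ζ _)) :=
    fun ζ => (pushField_app h L ζ hu).symm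
  have h6 : ∀ ζ : VField M, pushOp Φ L u (pushOp Φ L u (pushField Φ ζ u)) =
      dmap Φ (Φ.symm u) (planeOp L _ (planeOp L _ (planeVec ζ _))) :=
    fun ζ => by rw [← pushField_app h L ζ hu, ← pushField_app h L _ hu]; rfl
  have h7 : torsion (M := Plane) (pushOp Φ L) (pushField Φ ξ) (pushField Φ η) u =
      pushField Φ (VectorField.mlieBracket (𝓡 2) (L.app ξ) (L.app η)) u
      + pushOp Φ L u (pushOp Φ L u (pushField Φ (VectorField.mlieBracket (𝓡 2) ξ η) u))
      - pushOp Φ L u (pushField Φ (VectorField.mlieBracket (𝓡 2) (L.app ξ) η) u)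
      - pushOp Φ L u (pushField Φ (VectorField.mlieBracket (𝓡 2) ξ (L.app η)) u) := by
    rw [h1, h2, h3, h4]; rfl
  refine h7.trans ?_
  rw [h6, h5, h5, pushField, ← map_add, ← map_sub, ← map_sub]
  rfl

theorem lieDerivOp_pushOp (h : IsLocalAnalyticDiffeo Φ p u₀) {L : OpField M}
    (hL : AnalyticOpField L) {e ξ : VField M} {u : Plane} (hu : u ∈ Φ.target)
    (he : AnalyticVFieldAt e (Φ.symm u)) (hξ : AnalyticVFieldAt ξ (Φ.symm u)) :
    lieDerivOp (M := Plane) (pushField Φ e) (pushOp Φ L) (pushField Φ ξ) u =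
      pushField Φ (lieDerivOp e L ξ) u := by
  have hξ' := pushField_app_eventuallyEq h L ξ hu
  have rfl' : ∀ ζ : VField M, pushField Φ ζ =ᶠ[𝓝 u] pushField Φ ζ := fun ζ => .rfl
  have h2 := pushField_mlieBracket h hu he hξ
  have h4 := (pushField_mlieBracket h hu he (hL.app hξ)).trans
    (Filter.EventuallyEq.mlieBracket_vectorField_eq (I := 𝓡 2) (rfl' e) hξ')
  have h5 : ∀ ζ : VField M, pushOp Φ L u (pushField Φ ζ u) =
      dmap Φ (Φ.symm u) (planeOp L _ (planeVec ζ _)) :=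
    fun ζ => (pushField_app h L ζ hu).symm
  have h7 : lieDerivOp (M := Plane) (pushField Φ e) (pushOp Φ L) (pushField Φ ξ) u =
      pushField Φ (VectorField.mlieBracket (𝓡 2) e (L.app ξ)) u
      - pushOp Φ L u (pushField Φ (VectorField.mlieBracket (𝓡 2) e ξ) u) := by
    rw [h2, h4]; rfl
  refine h7.trans ?_
  rw [h5, pushField, ← map_sub]
  rfl

variable {L : OpField M} {e : VField M}

/-- Because the torsion is a tensor, fields with constant coordinates `v` and `w` test every pair of
vectors. -/
theorem coordTorsion_pushOp (hLe : IsNijenhuisWithUnity L e) (h : IsLocalAnalyticDiffeo Φ p u₀)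
    {u : Plane} (hu : u ∈ Φ.target) (v w : Plane) : coordTorsion (pushOp Φ L) u v w = 0 := by
  obtain ⟨ξ, hξ, hξv⟩ := exists_pushField_eq h hu v
  obtain ⟨η, hη, hηw⟩ := exists_pushField_eq h hu w
  have h1 := torsion_pushOp h hLe.analytic_op hu hξ hη
  have h2 := torsion_plane (analyticAt_pushOp h hLe.analytic_op hu).differentiableAt
    (analyticAt_pushField h hu hξ).differentiableAt (analyticAt_pushField h hu hη).differentiableAt
  rw [hξv u hu, hηw u hu] at h2
  refine (h2.symm.trans h1).trans ?_
  have h3 : planeVec (torsion L ξ η) (Φ.symm u) = 0 := hLe.torsion_free _ ξ η hξ hη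
  rw [pushField, h3, map_zero]

theorem coordLieDeriv_pushOp (hLe : IsNijenhuisWithUnity L e) (h : IsLocalAnalyticDiffeo Φ p u₀)
    {u : Plane} (hu : u ∈ Φ.target) (v : Plane) :
    coordLieDeriv (pushField Φ e) (pushOp Φ L) u v = v := by
  obtain ⟨ξ, hξ, hξv⟩ := exists_pushField_eq h hu v
  have h1 := lieDerivOp_pushOp h hLe.analytic_op hu (hLe.analytic_field _) hξ
  have h2 := lieDerivOp_plane (e := pushField Φ e)
    (analyticAt_pushOp h hLe.analytic_op hu).differentiableAt
    (analyticAt_pushField h hu hξ).differentiableAt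
  rw [hξv u hu] at h2
  refine (h2.symm.trans h1).trans ?_
  have h3 : planeVec (lieDerivOp e L ξ) (Φ.symm u) = planeVec ξ (Φ.symm u) := hLe.unity _ ξ hξ
  rw [pushField, h3]
  exact hξv u hu

end Push

/-! ### Straightening the unity -/

section Normalization

/-- The trace of an operator on the plane. -/
def tr2 (A : Plane →L[ℝ] Plane) : ℝ := A ex 0 + A ey 1

theorem clm_apply_coord (A : Plane →L[ℝ] Plane) (v : Plane) (i : Fin 2) :
    A v i = A ex i * v 0 + A ey i * v 1 := by
  conv_lhs => rw [eq_smul_add_smul v, map_add, map_smul, map_smul]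
  simp [mul_comm]

theorem tr2_comp_comm (A B : Plane →L[ℝ] Plane) : tr2 (A.comp B) = tr2 (B.comp A) := by
  simp only [tr2, ContinuousLinearMap.comp_apply]
  rw [clm_apply_coord A (B ex), clm_apply_coord A (B ey), clm_apply_coord B (A ex),
    clm_apply_coord B (A ey)]
  ring

theorem analyticAt_apply {L : Plane → Plane →L[ℝ] Plane} {u : Plane} (hL : AnalyticAt ℝ L u)
    (v : Plane) (i : Fin 2) : AnalyticAt ℝ (fun z => L z v i) u :=
  (((coord i).comp (ContinuousLinearMap.apply ℝ Plane v)).analyticAt _).fun_comp hL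

theorem fderiv_apply_coord {L : Plane → Plane →L[ℝ] Plane} {u : Plane}
    (hL : DifferentiableAt ℝ L u) (v w : Plane) (i : Fin 2) :
    fderiv ℝ (fun z => L z w i) u v = fderiv ℝ L u v w i := by
  rw [fderiv_clm_apply_const hL]
  exact fderiv_coord (hL.clm_apply (differentiableAt_const w)) i v

theorem fderiv_tr2 {L : Plane → Plane →L[ℝ] Plane} {u : Plane} (hL : DifferentiableAt ℝ L u)
    (v : Plane) : fderiv ℝ (fun z => tr2 (L z)) u v = tr2 (fderiv ℝ L u v) := by
  have h : ∀ (w : Plane) (i : Fin 2), DifferentiableAt ℝ (fun z => L z w i) u := fun w i =>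
    differentiableAt_euclidean.1 (hL.clm_apply (differentiableAt_const w)) i
  have h1 := (h ex 0).hasFDerivAt.add (h ey 1).hasFDerivAt
  have h2 : fderiv ℝ (fun z => tr2 (L z)) u v = _ :=
    congrArg (fun A : Plane →L[ℝ] ℝ => A v) h1.fderiv
  rw [h2, add_apply, fderiv_apply_coord hL, fderiv_apply_coord hL]
  rfl

/-- The derivative of the trace along a unity equals `2`. -/
theorem fderiv_tr2_unity {L : Plane → Plane →L[ℝ] Plane} {e : Plane → Plane} {u : Plane}
    (hL : DifferentiableAt ℝ L u) (h : ∀ v, coordLieDeriv e L u v = v) :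
    fderiv ℝ (fun z => tr2 (L z)) u (e u) = 2 := by
  have h0 := congrArg (fun u : Plane => u 0) (h ex)
  have h1 := congrArg (fun u : Plane => u 1) (h ey)
  -- The terms `L ∘ De` and `De ∘ L` have equal traces and cancel, leaving `tr (DL(e)) = tr Id = 2`.
  have h2 := tr2_comp_comm (L u) (fderiv ℝ e u)
  rw [fderiv_tr2 hL]
  simp only [coordLieDeriv, PiLp.add_apply, PiLp.sub_apply, tr2, ContinuousLinearMap.comp_apply]
    at h0 h1 h2 ⊢
  simp at h0 h1 h2 ⊢
  linarith

/-- A nonzero `J` killing `e` cannot be proportional to `X`, which does not kill `e`. This makes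
half the trace and a first integral into local coordinates. -/
theorem fderiv_pair_injective {X J : Plane →L[ℝ] ℝ} {e : Plane} (hX : X e = 1) (hJ : J e = 0)
    (hJ0 : J ≠ 0) {v : Plane} (h1 : X v = 0) (h2 : J v = 0) : v = 0 := by
  have key : ∀ (A : Plane →L[ℝ] ℝ) (w : Plane), A w = A ex * w 0 + A ey * w 1 := by
    intro A w
    conv_lhs => rw [eq_smul_add_smul w, map_add, map_smul, map_smul]
    simp [mul_comm]
  rw [key] at hX hJ h1 h2
  have hdet : X ex * J ey - X ey * J ex ≠ 0 := by
    intro hdet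
    have hc : J ex = 0 := by linear_combination -J ex * hX + X ex * hJ - e 1 * hdet
    have hd : J ey = 0 := by linear_combination -J ey * hX + X ey * hJ + e 0 * hdet
    refine hJ0 ?_
    ext w
    rw [key, hc, hd]; simp
  refine plane_ext ?_ ?_
  · have : (X ex * J ey - X ey * J ex) * v 0 = 0 := by linear_combination J ey * h1 - X ey * h2
    simpa [hdet] using this
  · have : (X ex * J ey - X ey * J ex) * v 1 = 0 := by linear_combination X ex * h2 - J ex * h1
    simpa [hdet] using this

variable {M : Type*} [TopologicalSpace M] [ChartedSpace Plane M]

theorem dmap_trans {Φ : OpenPartialHomeomorph M Plane} {Ψ : OpenPartialHomeomorph Plane Plane}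
    {p : M} {u₀ u₁ : Plane} (hΦ : IsLocalAnalyticDiffeo Φ p u₀)
    (hΨ : IsLocalAnalyticDiffeo Ψ u₀ u₁) {q : M} (hq : q ∈ (Φ.trans Ψ).source) (v : Plane) :
    dmap (Φ.trans Ψ) q v = fderiv ℝ Ψ (Φ q) (dmap Φ q v) := by
  rw [OpenPartialHomeomorph.trans_source] at hq
  have hc : mfderiv (𝓡 2) (𝓡 2) (Φ.trans Ψ) q =
      (mfderiv (𝓡 2) (𝓡 2) Ψ (Φ q)).comp (mfderiv (𝓡 2) (𝓡 2) Φ q) :=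
    mfderiv_comp q (hΨ.mdifferentiableAt hq.2) (hΦ.mdifferentiableAt hq.1)
  rw [← mfderiv_eq_fderiv]
  exact congrArg (fun A : Plane →L[ℝ] Plane => A v) hc

variable [IsManifold (𝓡 2) ω M] {L : OpField M} {e : VField M}

theorem isLocalAnalyticDiffeo_chartAt (p : M) :
    IsLocalAnalyticDiffeo (chartAt Plane p) p (chartAt Plane p p) where
  mem_source := mem_chart_source _ p
  map_point := rfl
  analytic := contMDiffOn_chart
  analytic_symm := contMDiffOn_chart_symm

theorem tr2_pushOp {Φ : OpenPartialHomeomorph M Plane} {p : M} {u₀ : Plane}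
    (h : IsLocalAnalyticDiffeo Φ p u₀) {u : Plane} (hu : u ∈ Φ.target) :
    tr2 (pushOp Φ L u) = tr2 (planeOp L (Φ.symm u)) := by
  rw [pushOp, tr2_comp_comm]
  congr 1
  ext1 v
  simp only [ContinuousLinearMap.comp_apply, dsymm_dmap h hu]

/-- There are coordinates `(x, y)` in which the unity is `∂_x` and the trace of the operator is
`2 (l + x)`. -/
theorem exists_straightened (hLe : IsNijenhuisWithUnity L e) (p : M) :
    ∃ (l : ℝ) (L' : Plane → Plane →L[ℝ] Plane), PairEquiv L e p L' dX 0 ∧ AnalyticAt ℝ L' 0 ∧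
      ∀ᶠ u in 𝓝 (0 : Plane), (∀ v w, coordTorsion L' u v w = 0) ∧
        (∀ v, fderiv ℝ L' u ex v = v) ∧ tr2 (L' u) = 2 * (l + u 0) := by
  have hΦ := isLocalAnalyticDiffeo_chartAt p
  set Φ := chartAt Plane p with hΦdef
  set u₀ := Φ p with hu₀
  have hu₀t : u₀ ∈ Φ.target := Φ.map_source hΦ.mem_source
  have hL := fun u (hu : u ∈ Φ.target) => analyticAt_pushOp hΦ hLe.analytic_op hu
  have he := fun u (hu : u ∈ Φ.target) => analyticAt_pushField hΦ hu (hLe.analytic_field _)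
  have htr := fun u (hu : u ∈ Φ.target) => fderiv_tr2_unity (hL u hu).differentiableAt
    (coordLieDeriv_pushOp hLe hΦ hu)
  -- The trace has derivative `2` along the unity, so the unity cannot vanish.
  have he0 : pushField Φ e u₀ ≠ 0 := by
    intro h0
    have := htr u₀ hu₀t
    rw [h0, map_zero] at this
    norm_num at this
  obtain ⟨J, hJ, hJ0, hJd, hJe⟩ := exists_first_integral (he u₀ hu₀t) he0
  set l : ℝ := tr2 (pushOp Φ L u₀) / 2 with hl
  -- The future coordinate `x`: half the trace, shifted to vanish at the base point.
  let X : Plane → ℝ := fun u => tr2 (pushOp Φ L u) / 2 - l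
  have htra : ∀ u ∈ Φ.target, AnalyticAt ℝ (fun u => tr2 (pushOp Φ L u)) u := fun u hu =>
    (analyticAt_apply (hL u hu) ex 0).add (analyticAt_apply (hL u hu) ey 1)
  have hXa : ∀ u ∈ Φ.target, AnalyticAt ℝ X u := fun u hu =>
    ((htra u hu).div_const).sub analyticAt_const
  have hXe : ∀ u ∈ Φ.target, fderiv ℝ X u (pushField Φ e u) = 1 := by
    intro u hu
    have h1 : HasFDerivAt X ((2 : ℝ)⁻¹ • fderiv ℝ (fun u => tr2 (pushOp Φ L u)) u) u := by
      have := ((htra u hu).differentiableAt.hasFDerivAt.const_mul (2 : ℝ)⁻¹).sub_const l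
      refine this.congr_of_eventuallyEq (.of_forall fun z => ?_)
      simp only [X]; ring
    rw [h1.fderiv, smul_apply, htr u hu]
    norm_num
  let F : Plane → Plane := fun u => !₂[X u, J u]
  have hF : AnalyticAt ℝ F u₀ := analyticAt_mk (hXa u₀ hu₀t) hJ
  have hF0 : F u₀ = 0 := by
    refine plane_ext ?_ ?_
    · simp [F, X, hl]
    · simp [F, hJ0]
  have hinj : ∀ v, fderiv ℝ F u₀ v = 0 → v = 0 := by
    intro v hv
    rw [fderiv_mk (hXa u₀ hu₀t).differentiableAt hJ.differentiableAt] at hv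
    refine fderiv_pair_injective (hXe u₀ hu₀t) hJe.self_of_nhds hJd (v := v) ?_ ?_
    · simpa using congrArg (fun u : Plane => u 0) hv
    · simpa using congrArg (fun u : Plane => u 1) hv
  obtain ⟨Ψ, hΨ, hΨF⟩ := exists_isLocalAnalyticDiffeo hF hinj
  have hΨF' : (Ψ : Plane → Plane) = F := funext hΨF
  rw [hF0] at hΨ
  have hΘ := hΦ.trans hΨ
  set Θ := Φ.trans Ψ with hΘdef
  have h0t : (0 : Plane) ∈ Θ.target := by
    rw [← hΘ.map_point]; exact Θ.map_source hΘ.mem_source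
  have hΘs : Θ.symm 0 = p := by
    rw [← hΘ.map_point]; exact Θ.left_inv hΘ.mem_source
  have hsource : ∀ u ∈ Θ.target, Θ.symm u ∈ Φ.source ∧ Φ (Θ.symm u) ∈ Φ.target ∧
      Ψ (Φ (Θ.symm u)) = u := by
    intro u hu
    have h1 := Θ.map_target hu
    rw [hΘdef, OpenPartialHomeomorph.trans_source] at h1
    exact ⟨h1.1, Φ.map_source h1.1, Θ.right_inv hu⟩
  have hgood : ∀ᶠ q in 𝓝 p, fderiv ℝ J (Φ q) (pushField Φ e (Φ q)) = 0 ∧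
      DifferentiableAt ℝ J (Φ q) := by
    have hc : ContinuousAt Φ p := Φ.continuousAt hΦ.mem_source
    exact hc.eventually
      (hJe.and (hJ.eventually_analyticAt.mono fun _ h => h.differentiableAt))
  have hfield : ∀ u ∈ Θ.target, fderiv ℝ J (Φ (Θ.symm u)) (pushField Φ e (Φ (Θ.symm u))) = 0 ∧
      DifferentiableAt ℝ J (Φ (Θ.symm u)) → pushField Θ e u = ex := by
    intro u hu h
    obtain ⟨h1, h2, -⟩ := hsource u hu
    have h3 : pushField Φ e (Φ (Θ.symm u)) = dmap Φ (Θ.symm u) (planeVec e (Θ.symm u)) := by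
      rw [pushField, Φ.left_inv h1]
    rw [pushField, dmap_trans hΦ hΨ (Θ.map_target hu), ← h3]
    rw [hΨF', fderiv_mk (hXa _ h2).differentiableAt h.2, hXe _ h2, h.1]
  have hfield' : ∀ᶠ u in 𝓝 (0 : Plane), pushField Θ e u = ex := by
    have hc : ContinuousAt Θ.symm 0 := Θ.symm.continuousAt h0t
    rw [← hΘs] at hgood
    filter_upwards [hc.eventually hgood, Θ.open_target.mem_nhds h0t] with u h hu
    exact hfield u hu h
  refine ⟨l, pushOp Θ L, ?_, analyticAt_pushOp hΘ hLe.analytic_op h0t, ?_⟩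
  -- The unity must become `∂_x` on the whole source, so the source is restricted to where `J` is
  -- differentiable and constant along `e`.
  · refine ⟨Θ.restr _, hΘ.restr hgood, fun q hq v => ?_, fun q hq => ?_⟩
    · rw [OpenPartialHomeomorph.restr_source] at hq
      exact mapsOp_pushOp hΘ L q hq.1 v
    · rw [OpenPartialHomeomorph.restr_source] at hq
      have h1 := mapsField_pushField Θ e q hq.1
      refine h1.trans ?_
      have h2 := interior_subset hq.2
      refine hfield _ (Θ.map_source hq.1) ?_
      rw [Θ.left_inv hq.1]
      exact h2
  · filter_upwards [Θ.open_target.mem_nhds h0t, hfield'.eventually_nhds] with u hu hev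
    refine ⟨coordTorsion_pushOp hLe hΘ hu, fun v => ?_, ?_⟩
    · have h1 := coordLieDeriv_pushOp hLe hΘ hu v
      -- The unity is constant near `u`, so the Lie derivative reduces to `∂_x L`.
      have h2 : fderiv ℝ (pushField Θ e) u = 0 := by
        have h3 : pushField Θ e =ᶠ[𝓝 u] fun _ => ex := hev
        rw [h3.fderiv_eq, fderiv_fun_const]; rfl
      rw [coordLieDeriv, h2, hev.self_of_nhds] at h1
      simpa using h1
    · obtain ⟨h1, h2, h3⟩ := hsource u hu
      rw [tr2_pushOp hΘ hu]
      have h4 := tr2_pushOp (L := L) hΦ h2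
      rw [Φ.left_inv h1] at h4
      rw [← h4]
      have h5 : X (Φ (Θ.symm u)) = u 0 := by
        conv_rhs => rw [← h3, hΨF]
        rfl
      simp only [X] at h5
      linarith

end Normalization

/-! ### Reduction to functions of one variable -/

section Reduction

theorem norm_mk_mul_le (u : Plane) {t : ℝ} (ht : t ∈ Set.Icc (0 : ℝ) 1) :
    ‖(!₂[t * u 0, u 1] : Plane)‖ ≤ ‖u‖ := by
  rw [EuclideanSpace.norm_eq, EuclideanSpace.norm_eq]
  refine Real.sqrt_le_sqrt ?_
  simp only [Fin.sum_univ_two, Real.norm_eq_abs, sq_abs]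
  have h : (t * u 0) ^ 2 ≤ u 0 ^ 2 := by
    rw [mul_pow]
    exact mul_le_of_le_one_left (sq_nonneg _) (pow_le_one₀ ht.1 ht.2)
  simpa using h

/-- A function with vanishing derivative along `∂_x` depends on `y` alone. -/
theorem eventually_eq_of_fderiv_ex_eq_zero {f : Plane → ℝ}
    (hf : ∀ᶠ u in 𝓝 (0 : Plane), DifferentiableAt ℝ f u ∧ fderiv ℝ f u ex = 0) :
    ∀ᶠ u in 𝓝 (0 : Plane), f u = f !₂[0, u 1] := by
  obtain ⟨r, hr, h⟩ := Metric.eventually_nhds_iff.1 hf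
  filter_upwards [Metric.ball_mem_nhds (0 : Plane) hr] with u hu
  have hin : ∀ t ∈ Set.Icc (0 : ℝ) 1, dist (!₂[t * u 0, u 1] : Plane) 0 < r := by
    intro t ht
    rw [dist_zero_right]
    exact (norm_mk_mul_le u ht).trans_lt (by simpa using hu)
  have hd : ∀ t ∈ Set.Icc (0 : ℝ) 1,
      HasDerivWithinAt (fun t => f !₂[t * u 0, u 1]) ((fun _ => 0) t) (Set.Icc 0 1) t := by
    intro t ht
    have h1 := h (hin t ht)
    have h2 : HasDerivAt (fun t : ℝ => (!₂[t * u 0, u 1] : Plane)) (u 0 • ex) t := by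
      have h3 : HasDerivAt (fun t : ℝ => t • (u 0 • ex) + u 1 • ey) ((1 : ℝ) • (u 0 • ex)) t :=
        ((hasDerivAt_id t).smul_const _).add_const _
      rw [one_smul] at h3
      refine h3.congr_of_eventuallyEq (.of_forall fun s => ?_)
      refine plane_ext ?_ ?_ <;> simp
    have h4 := h1.1.hasFDerivAt.comp_hasDerivAt t h2
    rw [map_smul, h1.2, smul_zero] at h4
    exact h4.hasDerivWithinAt
  have h5 := norm_image_sub_le_of_norm_deriv_le_segment_01' hd (C := 0) (by simp)
  have h6 := norm_le_zero_iff.1 h5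
  have h7 : (!₂[1 * u 0, u 1] : Plane) = u := by refine plane_ext ?_ ?_ <;> simp
  simp only [h7, zero_mul] at h6
  linarith

theorem analyticAt_mk_zero (y : ℝ) : AnalyticAt ℝ (fun y : ℝ => (!₂[0, y] : Plane)) y :=
  analyticAt_mk analyticAt_const analyticAt_id

theorem eventually_mk_zero {P : Plane → Prop} (h : ∀ᶠ u in 𝓝 (0 : Plane), P u) :
    ∀ᶠ y in 𝓝 (0 : ℝ), P !₂[0, y] := by
  have h0 : (!₂[0, (0 : ℝ)] : Plane) = 0 := by refine plane_ext ?_ ?_ <;> simp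
  rw [← h0] at h
  exact (analyticAt_mk_zero 0).continuousAt.eventually h

/-- For `L = (a, b; c, d)` with `∂_x L = Id`, the second component of the torsion on `(∂_x, ∂_y)` is
`a - d + c · tr(∂_y L)`. -/
theorem diagonal_eq_of_coordTorsion_eq_zero {L : Plane → Plane →L[ℝ] Plane} {u : Plane}
    (hU : ∀ v, fderiv ℝ L u ex v = v) (htr : tr2 (fderiv ℝ L u ey) = 0)
    (hT : coordTorsion L u ex ey = 0) : L u ex 0 = L u ey 1 := by
  have h1 := congrArg (fun v : Plane => v 1) hT
  have key : ∀ v w : Plane, fderiv ℝ L u v w = v 0 • w + v 1 • fderiv ℝ L u ey w := by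
    intro v w
    conv_lhs => rw [eq_smul_add_smul v, map_add, map_smul, map_smul]
    simp only [add_apply, smul_apply, hU]
  simp only [coordTorsion, PiLp.add_apply, PiLp.sub_apply, hU] at h1
  rw [key (L u ex), key (L u ey), clm_apply_coord (L u) (fderiv ℝ L u ey ex)] at h1
  simp only [tr2] at htr
  simp at h1
  linear_combination h1 - (L u ex 1) * htr

/-- Both diagonal entries equal half the trace. The off-diagonal ones do not depend on `x`, because
`∂_x L = Id`. The first component of the torsion on `(∂_x, ∂_y)` is then `(bc)' - 2b`. -/
theorem exists_normalOp_of_straightened {l : ℝ} {L : Plane → Plane →L[ℝ] Plane}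
    (hL : AnalyticAt ℝ L 0)
    (h : ∀ᶠ u in 𝓝 (0 : Plane), (∀ v w, coordTorsion L u v w = 0) ∧
        (∀ v, fderiv ℝ L u ex v = v) ∧ tr2 (L u) = 2 * (l + u 0)) :
    ∃ b c : ℝ → ℝ, AnalyticAt ℝ b 0 ∧ AnalyticAt ℝ c 0 ∧
      (∀ᶠ u in 𝓝 (0 : Plane), L u = normalOp l b c u) ∧
      ∀ᶠ y in 𝓝 0, deriv b y * c y + b y * deriv c y = 2 * b y := by
  have h0 : (!₂[0, (0 : ℝ)] : Plane) = 0 := by refine plane_ext ?_ ?_ <;> simp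
  have hLa := hL.eventually_analyticAt
  have hdiag : ∀ᶠ u in 𝓝 (0 : Plane), L u ex 0 = l + u 0 ∧ L u ey 1 = l + u 0 := by
    filter_upwards [h, h.eventually_nhds, hLa] with u hu hev hLu
    have htr : tr2 (fderiv ℝ L u ey) = 0 := by
      rw [← fderiv_tr2 hLu.differentiableAt]
      have h1 : (fun z => tr2 (L z)) =ᶠ[𝓝 u] fun z => 2 * (l + z 0) := hev.mono fun z hz => hz.2.2
      have h2 : HasFDerivAt (fun z : Plane => 2 * (l + z 0)) ((2 : ℝ) • coord 0) u :=
        ((hasFDerivAt_coord 0 u).const_add l).const_mul 2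
      rw [h1.fderiv_eq, h2.fderiv]
      simp
    have h1 := diagonal_eq_of_coordTorsion_eq_zero hu.2.1 htr (hu.1 ex ey)
    have h2 := hu.2.2
    simp only [tr2] at h2
    constructor <;> linarith
  -- For a coordinate vector `w`, the condition `w i = 0` singles out an off-diagonal entry; its
  -- `∂_x`-derivative is `w i`.
  have hconst : ∀ (w : Plane) (i : Fin 2), w i = 0 →
      ∀ᶠ u in 𝓝 (0 : Plane), L u w i = L !₂[0, u 1] w i := by
    intro w i hw
    refine eventually_eq_of_fderiv_ex_eq_zero (f := fun u => L u w i) ?_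
    filter_upwards [h, hLa] with u hu hLu
    refine ⟨(analyticAt_apply hLu w i).differentiableAt, ?_⟩
    rw [fderiv_apply_coord hLu.differentiableAt, hu.2.1, hw]
  have hbc : ∀ (w : Plane) (i : Fin 2), AnalyticAt ℝ (fun y : ℝ => L !₂[0, y] w i) 0 := by
    intro w i
    refine AnalyticAt.fun_comp (g := fun u => L u w i) (f := fun y : ℝ => (!₂[0, y] : Plane)) ?_
      (analyticAt_mk_zero 0)
    rw [h0]
    exact analyticAt_apply hL w i
  set b : ℝ → ℝ := fun y => L !₂[0, y] ey 0 with hb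
  set c : ℝ → ℝ := fun y => L !₂[0, y] ex 1 with hc
  have heq : ∀ᶠ u in 𝓝 (0 : Plane), L u = normalOp l b c u := by
    filter_upwards [hdiag, hconst ey 0 (by simp), hconst ex 1 (by simp)] with u h1 h2 h3
    ext1 v
    rw [normalOp_apply]
    refine plane_ext ?_ ?_
    · rw [clm_apply_coord, h1.1, h2]; simp [b]
    · rw [clm_apply_coord, h1.2, h3]; simp [c]
  refine ⟨b, c, hbc ey 0, hbc ex 1, heq, ?_⟩
  have hT : ∀ᶠ u in 𝓝 (0 : Plane), coordTorsion (normalOp l b c) u ex ey = 0 := by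
    filter_upwards [h, heq.eventually_nhds] with u hu hev
    have h1 : L =ᶠ[𝓝 u] normalOp l b c := hev
    have h2 := hu.1 ex ey
    rwa [coordTorsion, h1.fderiv_eq, h1.self_of_nhds] at h2
  filter_upwards [eventually_mk_zero hT, (hbc ey 0).eventually_analyticAt,
    (hbc ex 1).eventually_analyticAt] with y hy hby hcy
  have h1 := congrArg (fun v : Plane => v 0) hy
  simp only [coordTorsion] at h1
  rw [fderiv_normalOp (by simpa using hby) (by simpa using hcy),
    fderiv_normalOp (by simpa using hby) (by simpa using hcy),
    fderiv_normalOp (by simpa using hby) (by simpa using hcy),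
    fderiv_normalOp (by simpa using hby) (by simpa using hcy)] at h1
  simp only [normalOp_apply] at h1
  simp at h1
  linear_combination h1

variable {M : Type*} [TopologicalSpace M] [ChartedSpace Plane M]

/-- Every Nijenhuis operator with a unity is locally equivalent to some `normalOp l b c`, with
unity `∂_x`. -/
theorem exists_pairEquiv_normalOp [IsManifold (𝓡 2) ω M] {L : OpField M} {e : VField M}
    (hLe : IsNijenhuisWithUnity L e) (p : M) :
    ∃ (l : ℝ) (b c : ℝ → ℝ), PairEquiv L e p (normalOp l b c) dX 0 ∧ AnalyticAt ℝ b 0 ∧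
      AnalyticAt ℝ c 0 ∧ ∀ᶠ y in 𝓝 0, deriv b y * c y + b y * deriv c y = 2 * b y := by
  obtain ⟨l, L', hequiv, hL', h⟩ := exists_straightened hLe p
  obtain ⟨b, c, hb, hc, heq, hbc⟩ := exists_normalOp_of_straightened hL' h
  refine ⟨l, b, c, hequiv.trans ?_, hb, hc, hbc⟩
  refine PairEquiv.of_eventually (F := id) analyticAt_id rfl (fun v hv => by simpa using hv) ?_ ?_
  · filter_upwards [heq] with u hu v
    simp only [fderiv_id, id_eq]
    exact congrArg (fun A : Plane →L[ℝ] Plane => A v) hu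
  · filter_upwards with u
    simp only [fderiv_id, id_eq]
    rfl

end Reduction

/-! ### Normal forms in one variable -/

section NormalForms

/-- The effect of a change of the coordinate `y`. -/
theorem pairEquiv_normalOp {l : ℝ} {b c b' c' φ : ℝ → ℝ} (hφ : AnalyticAt ℝ φ 0) (hφ0 : φ 0 = 0)
    (hφd : deriv φ 0 ≠ 0) (hb : ∀ᶠ y in 𝓝 0, b y = deriv φ y * b' (φ y))
    (hc : ∀ᶠ y in 𝓝 0, deriv φ y * c y = c' (φ y)) :
    PairEquiv (M := Plane) (normalOp l b c) dX 0 (normalOp l b' c') dX 0 := by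
  let F : Plane → Plane := fun u => !₂[u 0, φ (u 1)]
  have hcoord : ContinuousAt (fun u : Plane => u 1) 0 := (coord 1).continuous.continuousAt
  have hFd : ∀ u : Plane, AnalyticAt ℝ φ (u 1) → ∀ v, fderiv ℝ F u v = !₂[v 0, deriv φ (u 1) * v 1] := by
    intro u hu v
    have h1 := hasFDerivAt_comp_coord (i := 1) (u := u) hu.differentiableAt
    rw [fderiv_mk (hasFDerivAt_coord 0 u).differentiableAt h1.differentiableAt,
      (hasFDerivAt_coord 0 u).fderiv, h1.fderiv]
    simp
  refine PairEquiv.of_eventually (F := F) ?_ ?_ ?_ ?_ ?_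
  · exact analyticAt_mk ((coord 0).analyticAt _) (analyticAt_comp_coord (by simpa using hφ))
  · refine plane_ext ?_ ?_ <;> simp [F, hφ0]
  · intro v hv
    rw [hFd 0 (by simpa using hφ)] at hv
    have h0 := congrArg (fun u : Plane => u 0) hv
    have h1 := congrArg (fun u : Plane => u 1) hv
    simp [hφd] at h0 h1
    exact plane_ext (by simpa using h0) (by simpa using h1)
  · filter_upwards [hcoord.eventually hφ.eventually_analyticAt, hcoord.eventually hb,
      hcoord.eventually hc] with u h1 h2 h3 v
    have key : ∀ v : Plane, fderiv ℝ F u (normalOp l b c u v) =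
        normalOp l b' c' (F u) (fderiv ℝ F u v) := by
      intro v
      rw [hFd u h1, hFd u h1, normalOp_apply, normalOp_apply]
      refine plane_ext ?_ ?_
      · simp [F, h2]; ring
      · simp only [F]; simp; linear_combination v 0 * h3
    exact key v
  · filter_upwards [hcoord.eventually hφ.eventually_analyticAt] with u h1
    have key : fderiv ℝ F u ex = ex := by
      rw [hFd u h1]; refine plane_ext ?_ ?_ <;> simp
    exact key

/-- The coordinate `φ = b(0)c(0) - bc` has `φ' = -2b`. Hence `b = φ' · (-1/2)` and `φ'c = -2bc = 2(φ
- b(0)c(0))`, which fixes `d`. -/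
theorem pairEquiv_form₂ {l : ℝ} {b c : ℝ → ℝ} (hb : AnalyticAt ℝ b 0) (hc : AnalyticAt ℝ c 0)
    (h : ∀ᶠ y in 𝓝 0, deriv (fun y => b y * c y) y = 2 * b y) (h0 : b 0 ≠ 0) :
    PairEquiv (M := Plane) (normalOp l b c) dX 0 (form₂ l (-(b 0 * c 0))) dX 0 := by
  rw [form₂_eq]
  have hd : ∀ y, deriv (fun y => b 0 * c 0 - b y * c y) y = - deriv (fun y => b y * c y) y :=
    fun y => deriv_const_sub _
  refine pairEquiv_normalOp (φ := fun y => b 0 * c 0 - b y * c y)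
    (analyticAt_const.sub (hb.mul hc)) (by simp) ?_ ?_ ?_
  · rw [hd, h.self_of_nhds]; simpa using h0
  · filter_upwards [h] with y hy
    rw [hd, hy]; ring
  · filter_upwards [h] with y hy
    rw [hd, hy]; ring

/-- Analytic `k`-th roots: a nonzero germ vanishing at `0` is `± φ ^ k` in some coordinate `φ`. -/
theorem exists_eq_pow {D : ℝ → ℝ} (hD : AnalyticAt ℝ D 0) (hD0 : D 0 = 0)
    (hne : ¬ ∀ᶠ y in 𝓝 0, D y = 0) :
    ∃ (s : ℝ) (k : ℕ) (φ : ℝ → ℝ), (s = 1 ∨ s = -1) ∧ 1 ≤ k ∧ AnalyticAt ℝ φ 0 ∧ φ 0 = 0 ∧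
      deriv φ 0 ≠ 0 ∧ ∀ᶠ y in 𝓝 0, D y = -s * φ y ^ k := by
  obtain ⟨k, g, hg, hg0, hgD⟩ := hD.exists_eventuallyEq_pow_smul_nonzero_iff.2 hne
  have hk : 1 ≤ k := by
    rw [Nat.one_le_iff_ne_zero]
    rintro rfl
    have := hgD.self_of_nhds
    simp [hD0] at this
    exact hg0 this.symm
  obtain ⟨s, hs, hsg⟩ : ∃ s : ℝ, (s = 1 ∨ s = -1) ∧ 0 < -s * g 0 := by
    rcases lt_or_gt_of_ne hg0 with h | h
    · exact ⟨1, .inl rfl, by linarith⟩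
    · exact ⟨-1, .inr rfl, by linarith⟩
  have hs2 : s * s = 1 := by rcases hs with rfl | rfl <;> norm_num
  have hG : AnalyticAt ℝ (fun y => -s * g y) 0 := analyticAt_const.mul hg
  -- The positive `k`-th root of `-s g`. Since `s² = 1`, `D = y^k g = -s (y ρ)^k`.
  let ρ : ℝ → ℝ := fun y => Real.exp (Real.log (-s * g y) / k)
  have hρ : AnalyticAt ℝ ρ 0 := ((hG.log hsg).div_const).rexp'
  have hkR : (k : ℝ) ≠ 0 := by exact_mod_cast (Nat.one_le_iff_ne_zero.1 hk)
  have hderiv : HasDerivAt (fun y => y * ρ y) (ρ 0) 0 := by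
    have h := (hasDerivAt_id (0 : ℝ)).fun_mul hρ.differentiableAt.hasDerivAt
    simpa using h
  refine ⟨s, k, fun y => y * ρ y, hs, hk, analyticAt_id.mul hρ, by simp, ?_, ?_⟩
  · rw [hderiv.deriv]; exact (Real.exp_pos _).ne'
  · have hpos : ∀ᶠ y in 𝓝 (0 : ℝ), 0 < -s * g y :=
      hG.continuousAt.eventually (lt_mem_nhds hsg)
    filter_upwards [hgD, hpos] with y h1 h2
    have h3 : ρ y ^ k = -s * g y := by
      simp only [ρ]
      rw [← Real.exp_nat_mul, mul_div_cancel₀ _ hkR, Real.exp_log h2]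
    rw [h1, mul_pow, h3, sub_zero, smul_eq_mul]
    linear_combination (-y ^ k * g y) * hs2

/-- The product `bc` is not identically zero, as its derivative is `2b`; so `bc = -s φ^k`.
Differentiation yields `b`, and division by `b` yields `φ'c = 2φ/k`. -/
theorem exists_pairEquiv_form₃ {l : ℝ} {b c : ℝ → ℝ} (hb : AnalyticAt ℝ b 0)
    (hc : AnalyticAt ℝ c 0) (h : ∀ᶠ y in 𝓝 0, deriv (fun y => b y * c y) y = 2 * b y)
    (hbne : ¬ ∀ᶠ y in 𝓝 0, b y = 0) (h0 : b 0 * c 0 = 0) :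
    ∃ (s : ℝ) (k : ℕ), (s = 1 ∨ s = -1) ∧ 1 ≤ k ∧
      PairEquiv (M := Plane) (normalOp l b c) dX 0 (form₃ l s k) dX 0 := by
  have hne : ¬ ∀ᶠ y in 𝓝 0, b y * c y = 0 := by
    intro hz
    refine hbne ?_
    filter_upwards [h, hz.eventually_nhds] with y hy hev
    have h1 : (fun y => b y * c y) =ᶠ[𝓝 y] fun _ => 0 := hev
    rw [h1.deriv_eq, deriv_const] at hy
    linarith
  obtain ⟨s, k, φ, hs, hk, hφ, hφ0, hφd, hD⟩ := exists_eq_pow (hb.fun_mul hc) h0 hne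
  have hs0 : s ≠ 0 := by rcases hs with rfl | rfl <;> norm_num
  have hkR : (k : ℝ) ≠ 0 := by exact_mod_cast (Nat.one_le_iff_ne_zero.1 hk)
  have hbφ : ∀ᶠ y in 𝓝 0, b y = deriv φ y * (-s * ((k : ℝ) / 2) * φ y ^ (k - 1)) := by
    filter_upwards [h, hD.eventually_nhds, hφ.eventually_analyticAt] with y hy hev hφy
    have h1 : (fun y => b y * c y) =ᶠ[𝓝 y] fun y => -s * φ y ^ k := hev
    have h2 := (hφy.differentiableAt.hasDerivAt.pow k).const_mul (-s)
    have h3 : HasDerivAt (fun y => -s * φ y ^ k) (-s * (k * φ y ^ (k - 1) * deriv φ y)) y := h2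
    rw [h1.deriv_eq, h3.deriv] at hy
    linear_combination -hy / 2
  refine ⟨s, k, hs, hk, ?_⟩
  rw [form₃_eq]
  refine pairEquiv_normalOp hφ hφ0 hφd hbφ ?_
  have hcont1 : ContinuousAt (fun y => deriv φ y * c y) 0 :=
    hφ.deriv.continuousAt.mul hc.continuousAt
  have hcont2 : ContinuousAt (fun y => 2 / (k : ℝ) * φ y) 0 := continuousAt_const.mul hφ.continuousAt
  -- Division by `φ^(k-1)` is possible only away from `0`; continuity supplies the origin.
  refine (hcont1.eventuallyEq_nhds_iff_eventuallyEq_nhdsNE hcont2).1 ?_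
  have hφne : ∀ᶠ y in 𝓝[≠] 0, φ y ≠ 0 := by
    have := hφ.differentiableAt.hasDerivAt.eventually_ne (c := 0) hφd
    exact this
  filter_upwards [hφne, hbφ.filter_mono nhdsWithin_le_nhds, hD.filter_mono nhdsWithin_le_nhds]
    with y h1 h2 h3
  have h4 : φ y ^ k = φ y ^ (k - 1) * φ y := by
    rw [← pow_succ, Nat.sub_add_cancel hk]
  have h5 : φ y ^ (k - 1) ≠ 0 := pow_ne_zero _ h1
  rw [h2, h4] at h3
  have h6 : -s * φ y ^ (k - 1) * (deriv φ y * c y * k / 2 - φ y) = 0 := by linear_combination h3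
  have h7 : deriv φ y * c y * k / 2 - φ y = 0 := by
    simpa [hs0, h5] using h6
  field_simp
  linear_combination 2 * h7

variable {M : Type*} [TopologicalSpace M] [ChartedSpace Plane M]

theorem exists_normal_form [IsManifold (𝓡 2) ω M] {L : OpField M} {e : VField M}
    (hLe : IsNijenhuisWithUnity L e) (p : M) : ∃ l : ℝ,
      PairEquiv L e p (form₁ l) dX 0 ∨
      (∃ d : ℝ, PairEquiv L e p (form₂ l d) dX 0) ∨
      (∃ (s : ℝ) (k : ℕ), (s = 1 ∨ s = -1) ∧ 1 ≤ k ∧ PairEquiv L e p (form₃ l s k) dX 0) ∨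
      (∃ g : ℝ → ℝ, AnalyticAt ℝ g 0 ∧ PairEquiv L e p (form₄ l fun z => g z.2) dX 0) := by
  obtain ⟨l, b, c, hequiv, hb, hc, hbc⟩ := exists_pairEquiv_normalOp hLe p
  have h : ∀ᶠ y in 𝓝 0, deriv (fun y => b y * c y) y = 2 * b y := by
    filter_upwards [hbc, hb.eventually_analyticAt, hc.eventually_analyticAt] with y h1 h2 h3
    rw [← h1]
    exact (h2.differentiableAt.hasDerivAt.mul h3.differentiableAt.hasDerivAt).deriv
  refine ⟨l, ?_⟩
  -- Form 1, where `c = 0` as well, is absorbed here as form 4 with zero function.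
  by_cases hb0 : ∀ᶠ y in 𝓝 0, b y = 0
  · refine .inr (.inr (.inr ⟨c, hc, hequiv.trans ?_⟩))
    rw [form₄_eq]
    refine pairEquiv_normalOp (φ := id) analyticAt_id rfl (by simp) ?_ (by simp)
    simpa using hb0
  -- This includes `b(0) ≠ 0`, `c(0) = 0`: there `bc` has a simple zero, so `k = 1`.
  by_cases h0 : b 0 * c 0 = 0
  · obtain ⟨s, k, hs, hk, h3⟩ := exists_pairEquiv_form₃ (l := l) hb hc h hb0 h0
    exact .inr (.inr (.inl ⟨s, k, hs, hk, hequiv.trans h3⟩))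
  · exact .inr (.inl ⟨_, hequiv.trans (pairEquiv_form₂ hb hc h (left_ne_zero_of_mul h0))⟩)

theorem isModelNearZero_forms (l : ℝ) : IsModelNearZero (form₁ l) ∧
      (∀ d : ℝ, IsModelNearZero (form₂ l d)) ∧
      (∀ (s : ℝ) (k : ℕ), (s = 1 ∨ s = -1) → 1 ≤ k → IsModelNearZero (form₃ l s k)) ∧
      (∀ g : ℝ → ℝ, AnalyticAt ℝ g 0 → IsModelNearZero (form₄ l fun z => g z.2)) := by
  refine ⟨?_, fun d => ?_, fun s k _ hk => ?_, fun g hg => ?_⟩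
  · rw [form₁_eq]
    exact isModelNearZero_normalOp analyticAt_const analyticAt_const (.of_forall fun y => by simp)
  · rw [form₂_eq]
    refine isModelNearZero_normalOp analyticAt_const (by fun_prop) (.of_forall fun y => ?_)
    have h1 : HasDerivAt (fun y : ℝ => 2 * (y + d)) (2 * 1) y :=
      ((hasDerivAt_id y).add_const d).const_mul 2
    rw [h1.deriv, deriv_const]; ring
  · rw [form₃_eq]
    refine isModelNearZero_normalOp (by fun_prop) (by fun_prop) (.of_forall fun y => ?_)
    have hkR : (k : ℝ) ≠ 0 := by exact_mod_cast (Nat.one_le_iff_ne_zero.1 hk)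
    have h1 : HasDerivAt (fun y : ℝ => 2 / (k : ℝ) * y) (2 / (k : ℝ) * 1) y :=
      (hasDerivAt_id y).const_mul _
    have h2 : HasDerivAt (fun y : ℝ => -s * ((k : ℝ) / 2) * y ^ (k - 1))
        (-s * ((k : ℝ) / 2) * (((k - 1 : ℕ) : ℝ) * y ^ (k - 1 - 1))) y :=
      (hasDerivAt_pow (k - 1) y).const_mul _
    rw [h1.deriv, h2.deriv]
    obtain ⟨m, rfl⟩ := Nat.exists_eq_add_of_le' hk
    -- `k = 1` is separate: the upper right entry is constant and the exponent `k - 1 - 1` is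
    -- truncated.
    rcases m with _ | m
    · simp; ring
    · simp only [Nat.add_sub_cancel, pow_succ]
      push_cast at hkR ⊢
      field_simp
      ring
  · rw [form₄_eq]
    exact isModelNearZero_normalOp analyticAt_const hg (.of_forall fun y => by simp)

end NormalForms

/-! ### Equivalence of operators of the fourth form -/

section Equivalence

/-- The identification of the plane with `ℝ × ℝ`. -/
def toProd : Plane →L[ℝ] ℝ × ℝ := (coord 0).prod (coord 1)

theorem toProd_apply (u : Plane) : toProd u = (u 0, u 1) := rfl

theorem analyticAt_mk_prod (z : ℝ × ℝ) :
    AnalyticAt ℝ (fun z : ℝ × ℝ => (!₂[z.1, z.2] : Plane)) z :=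
  analyticAt_mk analyticAt_fst analyticAt_snd

theorem hasFDerivAt_comp_toProd {h : ℝ × ℝ → ℝ} {u : Plane}
    (hh : DifferentiableAt ℝ h (u 0, u 1)) :
    HasFDerivAt (fun u : Plane => h (u 0, u 1)) ((fderiv ℝ h (u 0, u 1)).comp toProd) u :=
  HasFDerivAt.comp (g := h) (f := toProd) u hh.hasFDerivAt toProd.hasFDerivAt

theorem deriv_snd_eq_fderiv {h : ℝ × ℝ → ℝ} {z : ℝ × ℝ} (hh : DifferentiableAt ℝ h z) :
    deriv (fun t => h (z.1, t)) z.2 = fderiv ℝ h z (0, 1) := by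
  have h1 : HasDerivAt (fun t : ℝ => (z.1, t)) ((0 : ℝ), (1 : ℝ)) z.2 :=
    (hasDerivAt_const _ _).prodMk (hasDerivAt_id _)
  exact (hh.hasFDerivAt.comp_hasDerivAt (f := fun t : ℝ => (z.1, t)) z.2 h1).deriv

/-- The diffeomorphism is `(x, y) ↦ (x, h(x, y))`. The terms with `h_x` cancel since both operators
have the same scalar part `l + x`, and the lower left entry is the equation for `h`. -/
theorem opEquiv_form₄_of_paramEquiv {l : ℝ} {f f' : ℝ × ℝ → ℝ} (h : ParamEquiv f f') :
    OpEquiv (form₄ l f) 0 (form₄ l f') 0 := by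
  obtain ⟨h, hh, hh0, hhd, heq⟩ := h
  let F : Plane → Plane := fun u => !₂[u 0, h (u 0, u 1)]
  have h00 : toProd 0 = (0, 0) := rfl
  have hFd : ∀ u : Plane, AnalyticAt ℝ h (u 0, u 1) → ∀ v, fderiv ℝ F u v =
      !₂[v 0, fderiv ℝ h (u 0, u 1) (1, 0) * v 0 + deriv (fun t => h (u 0, t)) (u 1) * v 1] := by
    intro u hu v
    have h1 := hasFDerivAt_comp_toProd hu.differentiableAt
    rw [fderiv_mk (hasFDerivAt_coord 0 u).differentiableAt h1.differentiableAt,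
      (hasFDerivAt_coord 0 u).fderiv, h1.fderiv]
    have h2 := deriv_snd_eq_fderiv hu.differentiableAt
    simp only at h2
    rw [h2]
    have h3 : toProd v = v 0 • ((1 : ℝ), (0 : ℝ)) + v 1 • ((0 : ℝ), (1 : ℝ)) := by
      simp [toProd_apply]
    rw [ContinuousLinearMap.comp_apply, h3, map_add, map_smul, map_smul]
    simp [mul_comm]
  have hcont : Filter.Tendsto toProd (𝓝 0) (𝓝 (0, 0)) := by
    have := toProd.continuous.tendsto 0
    rwa [h00] at this
  refine OpEquiv.of_eventually (F := F) ?_ ?_ ?_ ?_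
  · refine analyticAt_mk ((coord 0).analyticAt _) ?_
    refine AnalyticAt.fun_comp (g := h) (f := toProd) ?_ (toProd.analyticAt 0)
    rw [h00]; exact hh
  · refine plane_ext ?_ ?_ <;> simp [F, hh0]
  · intro v hv
    rw [hFd 0 (by simpa using hh)] at hv
    have h0 := congrArg (fun u : Plane => u 0) hv
    have h1 := congrArg (fun u : Plane => u 1) hv
    simp at h0 h1
    rw [h0] at h1
    simp [hhd] at h1
    exact plane_ext (by simpa using h0) (by simpa using h1)
  · filter_upwards [hcont.eventually hh.eventually_analyticAt, hcont.eventually heq] with u h1 h2 v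
    simp only [toProd_apply] at h1 h2
    have key : ∀ v : Plane, fderiv ℝ F u (form₄ l f u v) =
        form₄ l f' (F u) (fderiv ℝ F u v) := by
      intro v
      refine Eq.trans ?_ (form₄_apply l f' (F u) (fderiv ℝ F u v)).symm
      refine (congrArg (fderiv ℝ F u) (form₄_apply l f u v)).trans ?_
      rw [hFd u h1, hFd u h1]
      refine plane_ext ?_ ?_
      · simp [F]
      · simp only [F]; simp; linear_combination -v 0 * h2
    exact key v

theorem paramEquiv_of_opEquiv_form₄ {l : ℝ} {f f' : ℝ × ℝ → ℝ}
    (h : OpEquiv (form₄ l f) 0 (form₄ l f') 0) : ParamEquiv f f' := by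
  obtain ⟨Φ, hΦ, hL⟩ := h
  have hΦa : ∀ u ∈ Φ.source, AnalyticAt ℝ Φ u := fun u hu =>
    (contMDiffAt_iff_contDiffAt.1 (hΦ.contMDiffAt hu)).analyticAt
  have hdm : ∀ u, dmap Φ u = fderiv ℝ Φ u := fun u => mfderiv_eq_fderiv
  have hsurj : ∀ u ∈ Φ.source, ∀ v, ∃ w, fderiv ℝ Φ u w = v := by
    intro u hu v
    have h1 := dmap_dsymm hΦ (Φ.map_source hu) v
    rw [Φ.left_inv hu, hdm] at h1
    exact ⟨_, h1⟩
  have hinj : ∀ u ∈ Φ.source, ∀ v, fderiv ℝ Φ u v = 0 → v = 0 := by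
    intro u hu v hv
    have h1 := dsymm_apply_dmap hΦ hu v
    rw [hdm, hv, map_zero] at h1
    exact h1.symm
  have hcomm : ∀ u ∈ Φ.source, ∀ v : Plane,
      fderiv ℝ Φ u !₂[(l + u 0) * v 0, f (u 0, u 1) * v 0 + (l + u 0) * v 1] =
      !₂[(l + Φ u 0) * fderiv ℝ Φ u v 0, f' (Φ u 0, Φ u 1) * fderiv ℝ Φ u v 0 +
        (l + Φ u 0) * fderiv ℝ Φ u v 1] := by
    intro u hu v
    rw [← form₄_apply, ← form₄_apply, ← hdm]
    exact hL u hu v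
  -- Preservation of the eigenvalue. For the first row `(p, q)` of the differential and `X = Φ u 0`,
  -- the relations are `(X - x) q = 0` and `(X - x) p = f q`; if `X ≠ x`, the row vanishes,
  -- contradicting surjectivity.
  have hx : ∀ u ∈ Φ.source, Φ u 0 = u 0 := by
    intro u hu
    set A := fderiv ℝ Φ u with hA
    have h1 := congrArg (fun w : Plane => w 0) (hcomm u hu ex)
    have h2 := congrArg (fun w : Plane => w 0) (hcomm u hu ey)
    simp only [← hA] at h1 h2
    rw [clm_apply_coord] at h1 h2
    simp at h1 h2
    by_contra hne
    have hq : A ey 0 = 0 := by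
      have : (Φ u 0 - u 0) * A ey 0 = 0 := by linear_combination -h2
      exact (mul_eq_zero.1 this).resolve_left (sub_ne_zero.2 hne)
    have hp : A ex 0 = 0 := by
      have : (Φ u 0 - u 0) * A ex 0 = 0 := by linear_combination -h1 + f (u 0, u 1) * hq
      exact (mul_eq_zero.1 this).resolve_left (sub_ne_zero.2 hne)
    obtain ⟨w, hw⟩ := hsurj u hu ex
    have h3 := clm_apply_coord A w 0
    rw [hw, hp, hq] at h3
    simp at h3
  have hx' : ∀ u ∈ Φ.source, ∀ v, fderiv ℝ Φ u v 0 = v 0 := by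
    intro u hu v
    rw [← fderiv_coord (hΦa u hu).differentiableAt]
    have h1 : (fun x => Φ x 0) =ᶠ[𝓝 u] fun x => x 0 := by
      filter_upwards [Φ.open_source.mem_nhds hu] with x hxs using hx x hxs
    rw [h1.fderiv_eq, (hasFDerivAt_coord 0 u).fderiv]
    rfl
  let ι : ℝ × ℝ → Plane := fun z => !₂[z.1, z.2]
  have hι0 : ι (0, 0) = 0 := by refine plane_ext ?_ ?_ <;> simp [ι]
  have hΦ0 : AnalyticAt ℝ Φ (ι (0, 0)) := by rw [hι0]; exact hΦa 0 hΦ.mem_source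
  let h : ℝ × ℝ → ℝ := fun z => Φ (ι z) 1
  have hderiv : ∀ z, ι z ∈ Φ.source →
      deriv (fun t => h (z.1, t)) z.2 = fderiv ℝ Φ (ι z) ey 1 := by
    intro z hz
    have h1 : HasDerivAt (fun t : ℝ => ι (z.1, t)) ey z.2 := by
      have h3 : HasDerivAt (fun t : ℝ => t • ey + z.1 • ex) ((1 : ℝ) • ey) z.2 :=
        ((hasDerivAt_id z.2).smul_const _).add_const _
      rw [one_smul] at h3
      refine h3.congr_of_eventuallyEq (.of_forall fun s => ?_)
      refine plane_ext ?_ ?_ <;> simp [ι]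
    have h2 := (hΦa _ hz).differentiableAt.hasFDerivAt.comp_hasDerivAt
      (f := fun t : ℝ => ι (z.1, t)) z.2 h1
    exact ((coord 1).hasFDerivAt.comp_hasDerivAt z.2 h2).deriv
  refine ⟨h, analyticAt_coord (AnalyticAt.fun_comp (g := Φ) (f := ι) hΦ0 (analyticAt_mk_prod _)) 1,
    ?_, ?_, ?_⟩
  · simp [h, hι0, hΦ.map_point]
  · have h0s : ι (0, 0) ∈ Φ.source := by rw [hι0]; exact hΦ.mem_source
    rw [hderiv (0, 0) h0s]
    intro hz
    have h1 : fderiv ℝ Φ (ι (0, 0)) ey = 0 :=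
      plane_ext (by rw [hx' _ h0s]; simp) (by rw [hz]; simp)
    have h2 := congrArg (fun w : Plane => w 1) (hinj _ h0s _ h1)
    simp at h2
  · have hev : ∀ᶠ z in 𝓝 ((0, 0) : ℝ × ℝ), ι z ∈ Φ.source := by
      refine (analyticAt_mk_prod (0, 0)).continuousAt.eventually (Φ.open_source.mem_nhds ?_)
      change ι (0, 0) ∈ Φ.source
      rw [hι0]; exact hΦ.mem_source
    filter_upwards [hev] with z hz
    -- Second component of the relation on `∂_x`; the terms `(l + x) h_x` on the two sides cancel.
    have h1 := congrArg (fun w : Plane => w 1) (hcomm _ hz ex)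
    rw [hderiv z hz]
    simp only [hx' _ hz, hx _ hz] at h1
    rw [clm_apply_coord] at h1
    simp [ι] at h1
    change f' (z.1, Φ (ι z) 1) = _
    simp only [ι]
    linear_combination -h1

/-- With no dependence on `x` in the functions, the equation for `h` may be restricted to `x = 0`;
then `(x, y) ↦ (x, h(0, y))` also preserves `∂_x`. -/
theorem pairEquiv_form₄_of_paramEquiv {l : ℝ} {g g' : ℝ → ℝ}
    (h : ParamEquiv (fun z => g z.2) (fun z => g' z.2)) :
    PairEquiv (form₄ l fun z => g z.2) dX 0 (form₄ l fun z => g' z.2) dX 0 := by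
  obtain ⟨h, hh, hh0, hhd, heq⟩ := h
  rw [form₄_eq, form₄_eq]
  have hι : AnalyticAt ℝ (fun t : ℝ => ((0 : ℝ), t)) 0 := analyticAt_const.prod analyticAt_id
  refine pairEquiv_normalOp (φ := fun t => h (0, t))
    (AnalyticAt.fun_comp (g := h) (f := fun t : ℝ => ((0 : ℝ), t)) hh hι) hh0 hhd (by simp) ?_
  filter_upwards [hι.continuousAt.eventually heq] with y hy
  exact hy.symm

end Equivalence

end NijenhuisUnity

end

open NijenhuisUnity in
theorem mainTheorem4 :
    -- every pair can be brought to one of the four forms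
    (∀ (M : Type*) [TopologicalSpace M] [ChartedSpace Plane M] [IsManifold (𝓡 2) ω M]
        (L : OpField M) (e : VField M), IsNijenhuisWithUnity L e → ∀ p : M, ∃ l : ℝ,
      PairEquiv L e p (form₁ l) dX 0 ∨
      (∃ d : ℝ, PairEquiv L e p (form₂ l d) dX 0) ∨
      (∃ (s : ℝ) (k : ℕ), (s = 1 ∨ s = -1) ∧ 1 ≤ k ∧ PairEquiv L e p (form₃ l s k) dX 0) ∨
      (∃ g : ℝ → ℝ, AnalyticAt ℝ g 0 ∧ PairEquiv L e p (form₄ l fun z => g z.2) dX 0)) ∧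
    -- all these forms do occur, with arbitrary parameters
    (∀ l : ℝ, IsModelNearZero (form₁ l) ∧
      (∀ d : ℝ, IsModelNearZero (form₂ l d)) ∧
      (∀ (s : ℝ) (k : ℕ), (s = 1 ∨ s = -1) → 1 ≤ k → IsModelNearZero (form₃ l s k)) ∧
      (∀ g : ℝ → ℝ, AnalyticAt ℝ g 0 → IsModelNearZero (form₄ l fun z => g z.2))) ∧
    -- equivalence of operators of the fourth form, for functions of both variables
    (∀ (l : ℝ) (f f' : ℝ × ℝ → ℝ), AnalyticAt ℝ f (0, 0) → AnalyticAt ℝ f' (0, 0) →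
      (OpEquiv (form₄ l f) 0 (form₄ l f') 0 ↔ ParamEquiv f f')) ∧
    -- equivalence of pairs of the fourth form
    (∀ (l : ℝ) (g g' : ℝ → ℝ), AnalyticAt ℝ g 0 → AnalyticAt ℝ g' 0 →
      (PairEquiv (form₄ l fun z => g z.2) dX 0 (form₄ l fun z => g' z.2) dX 0 ↔
        ParamEquiv (fun z => g z.2) (fun z => g' z.2))) := by
  exact ⟨fun _ _ _ _ _ _ hLe p => exists_normal_form hLe p, isModelNearZero_forms,
    fun _ _ _ _ _ => ⟨paramEquiv_of_opEquiv_form₄, opEquiv_form₄_of_paramEquiv⟩,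
    -- Necessity for pairs follows from necessity for operators by forgetting the unity.
    fun _ _ _ _ _ => ⟨fun ⟨Φ, hΦ, hL, _⟩ => paramEquiv_of_opEquiv_form₄ ⟨Φ, hΦ, hL⟩,
      pairEquiv_form₄_of_paramEquiv⟩⟩
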